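/- Let $K$ be an algebraically closed field, let $N\ge 2$, and let $R=K[x_0,\dots,x_N]$ be the homogeneous coordinate ring of $\mathbb P^N=\mathbb P^N_K$. Let $A_0=m_1p_1+\dots+m_rp_r$ be a fat point scheme in $\mathbb P^N$, that is, the subscheme defined by $I_{A_0}=\bigcap_i I_{p_i}^{m_i}\subset R$, where $m_i\ge 0$ and $I_{p_i}$ is the ideal generated by the forms vanishing at $p_i$. Let $L_1,\dots,L_{n+1}$ ($n\ge 0$) be hyperplanes, not necessarily distinct, where $L_j$ is defined by the linear form $F_j$. Let $A_j$ be the residual of $A_{j-1}$ with respect to $L_j$, i.e. $I_{A_j}=(I_{A_{j-1}}:F_j)$ for $1\le j\le n+1$. Assume that $L_1,\dots,L_{n+1}$ totally reduce $A_0$, i.e. $A_{n+1}=\varnothing$. For $0\le i\le n$ let $\overline{A_i}=L_{i+1}\cap A_i$ (scheme-theoretic intersection) and let $\mathcal I_{\overline{A_i},L_{i+1}}$ be its ideal sheaf in $L_{i+1}$. Write $\deg(A)=h^0(A,\mathcal O_A)$ for a zero-dimensional or empty scheme $A$, and set $\binom{a}{N}=0$ when $a<0$. Let $t\in\mathbb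 Z$ and put \[ h_i=h^0\big(L_{i+1},\mathcal I_{\overline{A_i},L_{i+1}}(t-i)\big)+h^0\big(\mathcal O_{\mathbb P^N}(t-(i+1))\big)-\deg(A_{i+1})\qquad(0\le i<n), \] \[ h_n=h^0\big(L_{n+1},\mathcal I_{\overline{A_n},L_{n+1}}(t-n)\big)+\binom{t-(n+1)+N}{N}, \] \[ h_i'=h^0\big(\mathcal O_{\mathbb P^N}(t-i)\big)-\deg(A_i)\quad(0\le i\le n),\qquad h_{n+1}'=h^0\big(\mathcal O_{\mathbb P^N}(t-(n+1))\big). \] Then all the dimensions involved are finite and \[ \max_{0\le i\le n+1}h_i'\;\le\;\max_{0\le i\le n}h_i\;\le\;h^0\big(\mathbb P^N,\mathcal I_{A_0}(t)\big)\;\le\;\binom{t-n+N-1}{N}+\sum_{i=0}^{n}h^0\big(L_{i+1},\mathcal I_{\overline{A_i},L_{i+1}}(t-i)\big). \] -/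

import Mathlib

open scoped LinearAlgebra.Projectivization

attribute [local instance] MvPolynomial.gradedAlgebra

noncomputable section

namespace FatPoints

section Sheaf

variable {K R : Type*} [Field K] [CommRing R] [Algebra K R]
variable (𝒜 : ℕ → Submodule K R) [GradedAlgebra 𝒜]

/-- The stalk at `q ∈ Proj R` of the `R`-module `R ⧸ Y`, i.e. the localization `(R ⧸ Y)_q`. -/
def Stalk (Y : Ideal R) (q : ProjectiveSpectrum 𝒜) : Type _ :=
  LocalizedModule q.asHomogeneousIdeal.toIdeal.primeCompl (R ⧸ Y)

instance (Y : Ideal R) (q : ProjectiveSpectrum 𝒜) : AddCommGroup (Stalk 𝒜 Y q) :=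
  inferInstanceAs
    (AddCommGroup (LocalizedModule q.asHomogeneousIdeal.toIdeal.primeCompl (R ⧸ Y)))

instance (Y : Ideal R) (q : ProjectiveSpectrum 𝒜) : Module R (Stalk 𝒜 Y q) :=
  inferInstanceAs
    (Module R (LocalizedModule q.asHomogeneousIdeal.toIdeal.primeCompl (R ⧸ Y)))

instance (Y : Ideal R) (q : ProjectiveSpectrum 𝒜) : Module K (Stalk 𝒜 Y q) :=
  inferInstanceAs
    (Module K (LocalizedModule q.asHomogeneousIdeal.toIdeal.primeCompl (R ⧸ Y)))

/-- The element `a / b` of the stalk `(R ⧸ Y)_q`, for `b ∉ q`. -/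
def Stalk.mk (Y : Ideal R) (q : ProjectiveSpectrum 𝒜) (a b : R)
    (hb : b ∉ q.asHomogeneousIdeal.toIdeal) : Stalk 𝒜 Y q :=
  LocalizedModule.mk (Ideal.Quotient.mk Y a) ⟨b, Ideal.mem_primeCompl_iff.2 hb⟩

/-- On the set `V ⊆ Proj R`, the family `s` is given by a single fraction `a / b` of degree `t`
with `a ∈ J` and `b` homogeneous and nowhere zero on `V`. -/
def IsFractionOn (Y J : Ideal R) (t : ℤ) (V : Set (ProjectiveSpectrum 𝒜))
    (s : ∀ q : ProjectiveSpectrum 𝒜, Stalk 𝒜 Y q) : Prop :=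
  ∃ d e : ℕ, (e : ℤ) = (d : ℤ) + t ∧ ∃ a ∈ 𝒜 e, a ∈ J ∧ ∃ b ∈ 𝒜 d,
    ∀ q ∈ V, ∃ hb : b ∉ q.asHomogeneousIdeal.toIdeal,
      s q = Stalk.mk 𝒜 Y q a b hb

variable {𝒜} in
/-- Every point of `Proj R` has a neighbourhood on which some homogeneous element of large degree
does not vanish. -/
theorem exists_denominator (t : ℤ) (p : ProjectiveSpectrum 𝒜) :
    ∃ d e : ℕ, (e : ℤ) = (d : ℤ) + t ∧ ∃ b ∈ 𝒜 d, b ∉ p.asHomogeneousIdeal.toIdeal := by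
  have h : ∃ k : ℕ, 0 < k ∧ ∃ f ∈ 𝒜 k, f ∉ p.asHomogeneousIdeal.toIdeal := by
    by_contra hcon
    push Not at hcon
    refine p.not_irrelevant_le fun x hx => ?_
    have hx' : (x : R) ∈ HomogeneousIdeal.irrelevant 𝒜 := hx
    rw [HomogeneousIdeal.mem_irrelevant_iff, GradedRing.proj_apply] at hx'
    change x ∈ p.asHomogeneousIdeal.toIdeal
    classical
    rw [← DirectSum.sum_support_decompose 𝒜 x]
    refine Ideal.sum_mem _ fun i _ => ?_
    rcases Nat.eq_zero_or_pos i with rfl | hi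
    · rw [hx']; exact Ideal.zero_mem _
    · exact hcon i hi _ (SetLike.coe_mem _)
  obtain ⟨k, hk, f, hf, hfp⟩ := h
  refine ⟨t.natAbs * k, (((t.natAbs * k : ℕ) : ℤ) + t).toNat, ?_, f ^ t.natAbs, ?_, ?_⟩
  · rw [Int.toNat_of_nonneg]
    have h1 : t.natAbs ≤ t.natAbs * k := Nat.le_mul_of_pos_right _ hk
    omega
  · simpa using SetLike.pow_mem_graded t.natAbs hf
  · exact fun h => hfp (p.isPrime.mem_of_pow_mem _ h)

/-- Let `X = Proj R`, let `Y` and `J` be homogeneous ideals, and let `M` be the graded `R`-module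
`(J + Y) / Y ⊆ R / Y`. This is the `K`-vector space `H⁰(X, M(t)~)` of global sections of the sheaf
associated to `M` and twisted by `t`: families of elements of the stalks which are locally
fractions `a / b` with `a ∈ M` and `b ∈ R` homogeneous and `deg a - deg b = t`.
Equivalently, these are the sections over the closed subscheme `V(Y) = Proj (R / Y)`, twisted by
`t`, of the ideal sheaf of `V(J) ∩ V(Y)` in `V(Y)` (extended by zero to `X`). -/
def sections (Y J : Ideal R) (t : ℤ) :
    Submodule K (∀ q : ProjectiveSpectrum 𝒜, Stalk 𝒜 Y q) where
  carrier := {s | ∀ p : ProjectiveSpectrum 𝒜, ∃ V : Set (ProjectiveSpectrum 𝒜),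
    IsOpen V ∧ p ∈ V ∧ IsFractionOn 𝒜 Y J t V s}
  zero_mem' := by
    intro p
    obtain ⟨d, e, hde, b, hb, hbp⟩ := exists_denominator t p
    refine ⟨ProjectiveSpectrum.basicOpen 𝒜 b, (ProjectiveSpectrum.basicOpen 𝒜 b).2, hbp,
      d, e, hde, 0, zero_mem _, zero_mem _, b, hb, fun q hq => ⟨hq, ?_⟩⟩
    exact (LocalizedModule.zero_mk (M := R ⧸ Y)
      (⟨b, Ideal.mem_primeCompl_iff.2 hq⟩ : q.asHomogeneousIdeal.toIdeal.primeCompl)).symm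
  add_mem' := by
    intro s s' hs hs' p
    obtain ⟨V, hV, hpV, d, e, hde, a, ha, haJ, b, hb, h⟩ := hs p
    obtain ⟨V', hV', hpV', d', e', hde', a', ha', haJ', b', hb', h'⟩ := hs' p
    have hadd : b' * a + b * a' ∈ 𝒜 (d + e') := by
      refine add_mem ?_ (SetLike.mul_mem_graded hb ha')
      have h0 : d' + e = d + e' := by omega
      rw [← h0]
      exact SetLike.mul_mem_graded hb' ha
    refine ⟨V ∩ V', hV.inter hV', ⟨hpV, hpV'⟩, d + d', d + e', by push_cast; omega,
      b' * a + b * a', hadd, add_mem (J.mul_mem_left _ haJ) (J.mul_mem_left _ haJ'),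
      b * b', SetLike.mul_mem_graded hb hb', fun q hq => ?_⟩
    obtain ⟨hbq, hsq⟩ := h q hq.1
    obtain ⟨hbq', hsq'⟩ := h' q hq.2
    refine ⟨fun hmem => (q.isPrime.mem_or_mem hmem).elim hbq hbq', ?_⟩
    rw [Pi.add_apply, hsq, hsq']
    exact LocalizedModule.mk_add_mk
  smul_mem' := by
    intro c s hs p
    obtain ⟨V, hV, hpV, d, e, hde, a, ha, haJ, b, hb, h⟩ := hs p
    refine ⟨V, hV, hpV, d, e, hde, c • a, Submodule.smul_mem _ _ ha,
      Submodule.smul_of_tower_mem J c haJ, b, hb, fun q hq => ?_⟩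
    obtain ⟨hbq, hsq⟩ := h q hq
    refine ⟨hbq, ?_⟩
    rw [Pi.smul_apply, hsq]
    exact LocalizedModule.smul'_mk _ _ _

end Sheaf

section ProjectiveSpace

variable {K : Type*} [Field K] {N : ℕ}

/-- The ideal of a point of `ℙ^N`: the ideal of `K[x₀, …, x_N]` generated by all forms that vanish
at the point. -/
def pointIdeal (p : ℙ K (Fin (N + 1) → K)) : Ideal (MvPolynomial (Fin (N + 1)) K) :=
  Ideal.span {f | (∃ d : ℕ, f.IsHomogeneous d) ∧ MvPolynomial.eval p.rep f = 0}

/-- The ideal `⋂ᵢ I_{pᵢ}^{mᵢ}` of the fat point scheme `m₁p₁ + ⋯ + m_r p_r`. -/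
def fatPointIdeal {r : ℕ} (p : Fin r → ℙ K (Fin (N + 1) → K)) (m : Fin r → ℕ) :
    Ideal (MvPolynomial (Fin (N + 1)) K) :=
  ⨅ i, pointIdeal (p i) ^ m i

/-- The ideals of the successive residuals `A₀ = A`, `A_{j+1} = A_j : L_{j+1}`, where `A` has ideal
`I` and the hyperplane `L_{j+1}` is defined by the linear form `F j`, for `j = 0, …, n`. -/
def residual (I : Ideal (MvPolynomial (Fin (N + 1)) K)) {n : ℕ}
    (F : Fin (n + 1) → MvPolynomial (Fin (N + 1)) K) :
    Fin (n + 2) → Ideal (MvPolynomial (Fin (N + 1)) K) :=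
  Fin.induction (motive := fun _ => Ideal (MvPolynomial (Fin (N + 1)) K)) I
    (fun j J => Submodule.colon J {F j})

/-- The hyperplanes totally reduce the scheme with ideal `I`: the last residual is the empty
subscheme of `ℙ^N`. -/
def TotallyReduces (I : Ideal (MvPolynomial (Fin (N + 1)) K)) {n : ℕ}
    (F : Fin (n + 1) → MvPolynomial (Fin (N + 1)) K) : Prop :=
  ProjectiveSpectrum.zeroLocus (MvPolynomial.homogeneousSubmodule (Fin (N + 1)) K)
    (residual I F (Fin.last (n + 1)) : Set (MvPolynomial (Fin (N + 1)) K)) = ∅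

/-- Global sections on `ℙ^N` of the twisted sheaf associated to `(J + Y) / Y`. -/
abbrev projSections (Y J : Ideal (MvPolynomial (Fin (N + 1)) K)) (t : ℤ) :=
  sections (MvPolynomial.homogeneousSubmodule (Fin (N + 1)) K) Y J t

variable (K N) in
/-- `H⁰(ℙ^N, 𝒪(t))`. -/
abbrev structureSections (t : ℤ) :=
  projSections (⊥ : Ideal (MvPolynomial (Fin (N + 1)) K)) ⊤ t

/-- `H⁰(ℙ^N, ℐ_A(t))`, where `I` is the ideal of `A`. -/
abbrev idealSections (I : Ideal (MvPolynomial (Fin (N + 1)) K)) (t : ℤ) :=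
  projSections ⊥ I t

/-- `H⁰(L, ℐ_{L ∩ A, L}(t))`, where `I` is the ideal of `A` and the hyperplane `L` is defined by
the linear form `F`: the ideal sheaf of `L ∩ A` in `L = Proj (K[x] / (F))` is the sheaf associated
to `(I + (F)) / (F)`. -/
abbrev traceSections (I : Ideal (MvPolynomial (Fin (N + 1)) K))
    (F : MvPolynomial (Fin (N + 1)) K) (t : ℤ) :=
  projSections (Ideal.span {F}) I t

/-- `H⁰(A, 𝒪_A)`, where `I` is the ideal of `A`. -/
abbrev schemeSections (I : Ideal (MvPolynomial (Fin (N + 1)) K)) :=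
  projSections I ⊤ 0

variable (K N) in
/-- `h⁰(ℙ^N, 𝒪(t))`. -/
def h0O (t : ℤ) : ℤ := Module.finrank K (structureSections K N t)

/-- `h⁰(ℙ^N, ℐ_A(t))`. -/
def h0Ideal (I : Ideal (MvPolynomial (Fin (N + 1)) K)) (t : ℤ) : ℤ :=
  Module.finrank K (idealSections I t)

/-- `h⁰(L, ℐ_{L ∩ A, L}(t))`. -/
def h0Trace (I : Ideal (MvPolynomial (Fin (N + 1)) K))
    (F : MvPolynomial (Fin (N + 1)) K) (t : ℤ) : ℤ :=
  Module.finrank K (traceSections I F t)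

/-- The degree of a zero-dimensional (or empty) subscheme `A` of `ℙ^N`: `dim_K H⁰(A, 𝒪_A)`. -/
def degree (I : Ideal (MvPolynomial (Fin (N + 1)) K)) : ℤ :=
  Module.finrank K (schemeSections I)

/-- The binomial coefficient `C(a, k)` for an integer `a`, equal to `0` when `a < 0` (and `k > 0`);
it counts the monomials of degree `a - k` in `k + 1` variables. -/
def binom (a : ℤ) (k : ℕ) : ℤ := (a.toNat.choose k : ℤ)

variable {n : ℕ}

/-- The numbers `h_i`, `0 ≤ i ≤ n`. -/
def lowerTerm (I : Ideal (MvPolynomial (Fin (N + 1)) K))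
    (F : Fin (n + 1) → MvPolynomial (Fin (N + 1)) K) (t : ℤ) (i : Fin (n + 1)) : ℤ :=
  if (i : ℕ) < n then
    h0Trace (residual I F i.castSucc) (F i) (t - (i : ℕ)) + h0O K N (t - ((i : ℕ) + 1))
      - degree (residual I F i.succ)
  else
    h0Trace (residual I F i.castSucc) (F i) (t - (n : ℕ)) + binom (t - ((n : ℕ) + 1) + N) N

/-- The numbers `h'_i`, `0 ≤ i ≤ n + 1`. -/
def lowerTerm' (I : Ideal (MvPolynomial (Fin (N + 1)) K))
    (F : Fin (n + 1) → MvPolynomial (Fin (N + 1)) K) (t : ℤ) (i : Fin (n + 2)) : ℤ :=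
  if (i : ℕ) ≤ n then
    h0O K N (t - (i : ℕ)) - degree (residual I F i)
  else
    h0O K N (t - ((n : ℕ) + 1))

end ProjectiveSpace

end FatPoints

end

noncomputable section

set_option linter.unusedSectionVars false

namespace FatPoints

/-! ### Germs, denominators and numerators of sections on `Proj`. -/

section Graded

variable {K R : Type*} [Field K] [CommRing R] [Algebra K R]
variable (𝒜 : ℕ → Submodule K R) [GradedAlgebra 𝒜]

/-! Write `I` for the ideal of a scheme `A` in the chain, `F` for the next linear form and `C = I :
F` for the residual. Both bounds come from the residual sequence `0 → ℐ_C(t-1) → ℐ_A(t) → ℐ_{L ∩ A,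
L}(t)`. Left exactness gives `h⁰(ℐ_A(t)) ≤ h⁰(ℐ_C(t-1)) + h⁰(trace)`, and telescoping down to the
empty scheme gives the upper bound. For the lower bounds, the cokernel on global sections sits in
`H¹(ℐ_C(t-1))`, which `deg C` controls; multiplication by `F` then carries the bound for `A_i` back
to `A_0`.

The proof replaces cohomology by Hilbert functions. By `sections_eq_map`, a quotient of depth at
least two has no sections beyond forms, so `h⁰(ℐ_A(t)) = dim I_t`. Likewise `h⁰(trace) = dim Q_t -
dim R_{t-1}`, where `Q` is the saturation of `I + (F)`; depth two for `R / (F)` is where `N ≥ 2`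
enters. By `IsZeroDimensional.schemeSections`, the degree is the stable value of the Hilbert
function of `R / I`. What remains is the comparison of `Q` with `I`. The upper bound is
`idealDim_le_saturation`; the two lower bounds are `saturation_le_idealDim_add`, where the role of
`H¹` is played by computing `I + (F) + (ℓ^k)` in a large degree, for a linear form `ℓ` regular
modulo `I`.

Fat point ideals fit this framework because an infinite field admits a linear form missing all the
points, and in adapted coordinates the power of a point ideal is a monomial ideal not involving
`x₀`. -/

instance (Y : Ideal R) (q : ProjectiveSpectrum 𝒜) : IsScalarTower K R (Stalk 𝒜 Y q) :=
  inferInstanceAs (IsScalarTower K R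
    (LocalizedModule q.asHomogeneousIdeal.toIdeal.primeCompl (R ⧸ Y)))

/-- The map `a ↦ a / 1` from `R` to the stalk `(R ⧸ Y)_q`. -/
def toStalk (Y : Ideal R) (q : ProjectiveSpectrum 𝒜) : R →ₗ[R] Stalk 𝒜 Y q :=
  (LocalizedModule.mkLinearMap q.asHomogeneousIdeal.toIdeal.primeCompl (R ⧸ Y)).comp
    (Submodule.mkQ Y)

variable {𝒜} {Y J : Ideal R}

theorem toStalk_eq_zero_iff {q : ProjectiveSpectrum 𝒜} {a : R} :
    toStalk 𝒜 Y q a = 0 ↔ ∃ u ∉ q.asHomogeneousIdeal.toIdeal, u * a ∈ Y := by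
  have h : toStalk 𝒜 Y q a = LocalizedModule.mk (Ideal.Quotient.mk Y a) 1 := rfl
  rw [h]
  constructor
  · intro h
    have h' := h.trans (LocalizedModule.zero_mk (M := R ⧸ Y) 1).symm
    obtain ⟨u, hu⟩ := LocalizedModule.mk_eq.1 h'
    refine ⟨u, u.2, ?_⟩
    simp only [one_smul, smul_zero] at hu
    rw [← Ideal.Quotient.eq_zero_iff_mem, map_mul]
    exact hu
  · rintro ⟨u, hu, hua⟩
    refine (LocalizedModule.mk_eq.2 ⟨⟨u, hu⟩, ?_⟩).trans
      (LocalizedModule.zero_mk (M := R ⧸ Y) 1)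
    simp only [one_smul, smul_zero]
    rw [← Ideal.Quotient.eq_zero_iff_mem, map_mul] at hua
    exact hua

theorem Stalk.smul_left_cancel {q : ProjectiveSpectrum 𝒜} {b : R}
    (hb : b ∉ q.asHomogeneousIdeal.toIdeal) {x y : Stalk 𝒜 Y q} (h : b • x = b • y) : x = y := by
  rw [← sub_eq_zero]
  refine LocalizedModule.eq_zero_of_smul_eq_zero b (Ideal.mem_primeCompl_iff.2 hb) _ ?_
  exact (smul_sub b x y).trans (sub_eq_zero.2 h)

theorem Stalk.smul_mk {q : ProjectiveSpectrum 𝒜} {a b : R}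
    (hb : b ∉ q.asHomogeneousIdeal.toIdeal) :
    b • Stalk.mk 𝒜 Y q a b hb = toStalk 𝒜 Y q a := by
  have h : toStalk 𝒜 Y q a = LocalizedModule.mk (Ideal.Quotient.mk Y a) 1 := rfl
  rw [h]
  refine (LocalizedModule.smul'_mk b _ _).trans ?_
  exact LocalizedModule.mk_cancel
    (⟨b, Ideal.mem_primeCompl_iff.2 hb⟩ : q.asHomogeneousIdeal.toIdeal.primeCompl) _

theorem Stalk.eq_mk_iff {q : ProjectiveSpectrum 𝒜} {a b : R}
    (hb : b ∉ q.asHomogeneousIdeal.toIdeal) {x : Stalk 𝒜 Y q} :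
    x = Stalk.mk 𝒜 Y q a b hb ↔ b • x = toStalk 𝒜 Y q a := by
  rw [← Stalk.smul_mk hb]
  exact ⟨fun h => by rw [h], fun h => Stalk.smul_left_cancel hb h⟩

theorem smul_toStalk {q : ProjectiveSpectrum 𝒜} (a b : R) :
    b • toStalk 𝒜 Y q a = toStalk 𝒜 Y q (b * a) := by
  rw [← smul_eq_mul, map_smul]

theorem toStalk_of_mem {q : ProjectiveSpectrum 𝒜} {a : R} (ha : a ∈ Y) :
    toStalk 𝒜 Y q a = 0 :=
  toStalk_eq_zero_iff.2 ⟨1, (Ideal.ne_top_iff_one _).1 q.isPrime.ne_top, by simpa using ha⟩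

theorem toStalk_eq_of_sub_mem {q : ProjectiveSpectrum 𝒜} {a b : R} (h : a - b ∈ Y) :
    toStalk 𝒜 Y q a = toStalk 𝒜 Y q b := by
  rw [← sub_eq_zero, ← map_sub, toStalk_of_mem h]

/-- The colon of a homogeneous ideal by a homogeneous element is homogeneous. -/
theorem isHomogeneous_colon {I : Ideal R} (hI : I.IsHomogeneous 𝒜) {e : ℕ} {f : R}
    (hf : f ∈ 𝒜 e) : (Submodule.colon I {f}).IsHomogeneous 𝒜 := by
  intro i r hr
  rw [Submodule.mem_colon_singleton, smul_eq_mul] at hr ⊢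
  rw [← DirectSum.coe_decompose_mul_add_of_right_mem 𝒜 hf]
  exact hI _ hr

/-- A homogeneous ideal with empty zero locus contains a power of every element of the
irrelevant ideal. -/
theorem irrelevant_le_radical {C : Ideal R} (hC : C.IsHomogeneous 𝒜)
    (h : ∀ q : ProjectiveSpectrum 𝒜, ∃ c ∈ C, c ∉ q.asHomogeneousIdeal.toIdeal) :
    (HomogeneousIdeal.irrelevant 𝒜).toIdeal ≤ C.radical := by
  rw [hC.radical_eq]
  refine le_sInf ?_
  rintro Q ⟨hQ, hCQ, hQp⟩
  by_contra hirr
  obtain ⟨c, hc, hcq⟩ := h ⟨⟨Q, hQ⟩, hQp, hirr⟩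
  exact hcq (hCQ hc)

theorem exists_irrelevant_notMem (q : ProjectiveSpectrum 𝒜) :
    ∃ d, 0 < d ∧ ∃ x ∈ 𝒜 d, x ∉ q.asHomogeneousIdeal.toIdeal := by
  -- The twist `-1` forces `d = e + 1`, so the degree is positive.
  obtain ⟨d, e, hde, b, hb, hbq⟩ := exists_denominator (-1) q
  exact ⟨d, by omega, b, hb, hbq⟩

theorem exists_component_notMem {q : ProjectiveSpectrum 𝒜} {f : R}
    (hf : f ∉ q.asHomogeneousIdeal.toIdeal) :
    ∃ i, (DirectSum.decompose 𝒜 f i : R) ∉ q.asHomogeneousIdeal.toIdeal := by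
  by_contra! hcon
  exact hf ((q.asHomogeneousIdeal.isHomogeneous.mem_iff).2 hcon)

/-- `a / b` is a fraction of degree `t` with numerator in `J` which represents `s` wherever the
form `b`, which has positive degree, does not vanish. -/
structure IsLocalFraction (J : Ideal R) (t : ℤ) (s : ∀ q : ProjectiveSpectrum 𝒜, Stalk 𝒜 Y q)
    (d e : ℕ) (a b : R) : Prop where
  pos : 0 < d
  deg : (e : ℤ) = d + t
  num_deg : a ∈ 𝒜 e
  num_mem : a ∈ J
  den_deg : b ∈ 𝒜 d
  smul_eq : ∀ q : ProjectiveSpectrum 𝒜, b ∉ q.asHomogeneousIdeal.toIdeal →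
    b • s q = toStalk 𝒜 Y q a

/-- Every neighbourhood of `p` contains the nonvanishing set of a form `g` with `g(p) ≠ 0`.
Expanding the given fraction by `g` makes the nonvanishing of the denominator imply membership in
the neighbourhood; a further factor makes the degree positive. -/
theorem exists_isLocalFraction {t : ℤ} {s : ∀ q : ProjectiveSpectrum 𝒜, Stalk 𝒜 Y q}
    (hs : s ∈ sections 𝒜 Y J t) (p : ProjectiveSpectrum 𝒜) :
    ∃ d e a b, IsLocalFraction J t s d e a b ∧ b ∉ p.asHomogeneousIdeal.toIdeal := by
  obtain ⟨V, hV, hpV, d, e, hde, a, ha, haJ, b, hb, hfr⟩ := hs p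
  obtain ⟨Z, hZ⟩ := (ProjectiveSpectrum.isOpen_iff 𝒜 V).1 hV
  have hpZ : ¬ Z ⊆ p.asHomogeneousIdeal := by
    intro h
    have : p ∈ Vᶜ := by rw [hZ]; exact h
    exact this hpV
  obtain ⟨z, hz, hzp⟩ := Set.not_subset.1 hpZ
  obtain ⟨i, hi⟩ := exists_component_notMem hzp
  obtain ⟨k, hk, x, hx, hxp⟩ := exists_irrelevant_notMem p
  set g : R := (DirectSum.decompose 𝒜 z i : R) * x with hg
  have hgd : g ∈ 𝒜 (i + k) := SetLike.mul_mem_graded (SetLike.coe_mem _) hx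
  have hbp : b ∉ p.asHomogeneousIdeal.toIdeal := (hfr p hpV).1
  refine ⟨i + k + d, i + k + e, g * a, g * b, ⟨by omega, by push_cast; omega,
    SetLike.mul_mem_graded hgd ha, J.mul_mem_left _ haJ, SetLike.mul_mem_graded hgd hb,
    fun q hq => ?_⟩, ?_⟩
  · have hqV : q ∈ V := by
      by_contra hqV
      have hqZ : q ∈ ProjectiveSpectrum.zeroLocus 𝒜 Z := by rw [← hZ]; exact hqV
      refine hq (Ideal.mul_mem_right _ _ (Ideal.mul_mem_right _ _ ?_))
      exact q.asHomogeneousIdeal.isHomogeneous i (hqZ hz)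
    obtain ⟨hbq, hsq⟩ := hfr q hqV
    rw [mul_smul, (Stalk.eq_mk_iff hbq).1 hsq, smul_toStalk]
  · intro h
    rcases p.isPrime.mem_or_mem h with h | h
    · exact (p.isPrime.mem_or_mem h).elim hi hxp
    · exact hbp h

/-- A section of the twisted sheaf of `(J + Y) / Y` has denominators from a set of forms
without common zero. -/
theorem exists_global_denominators [IsNoetherianRing R] (hY : Y.IsHomogeneous 𝒜) {t : ℤ}
    {s : ∀ q : ProjectiveSpectrum 𝒜, Stalk 𝒜 Y q} (hs : s ∈ sections 𝒜 Y J t) :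
    ∃ B : Set R, (∀ q : ProjectiveSpectrum 𝒜, ∃ b ∈ B, b ∉ q.asHomogeneousIdeal.toIdeal) ∧
      ∀ b ∈ B, ∃ d e : ℕ, (e : ℤ) = d + t ∧ b ∈ 𝒜 d ∧ ∃ a ∈ 𝒜 e, a ∈ J ∧
        ∀ q, b • s q = toStalk 𝒜 Y q a := by
  classical
  obtain ⟨T, hTB, hT⟩ := (Submodule.fg_span_iff_fg_span_finset_subset (R := R)
    {b : R | ∃ d e a, IsLocalFraction J t s d e a b}).1 (IsNoetherian.noetherian _)
  have hcov : ∀ q : ProjectiveSpectrum 𝒜, ∃ b ∈ T, b ∉ q.asHomogeneousIdeal.toIdeal := by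
    intro q
    by_contra! hcon
    obtain ⟨d, e, a, b, hab, hbq⟩ := exists_isLocalFraction hs q
    refine hbq ((Submodule.span_le.2 hcon : Submodule.span R (T : Set R) ≤ _) ?_)
    rw [← hT]
    exact Submodule.subset_span ⟨d, e, a, hab⟩
  have hTB' : ∀ b ∈ T, ∃ d e a, IsLocalFraction J t s d e a b := fun b hb => hTB hb
  choose! d e a hab using hTB'
  -- The two fractions agree where `b * b'` is nonzero, so `b * b'` lies in every homogeneous prime
  -- over the annihilator of the difference modulo `Y`. Primes containing the irrelevant ideal are
  -- harmless because `b` has positive degree.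
  have hpow : ∀ b ∈ T, ∀ b' ∈ T, ∃ k, (b * b') ^ k * (b' * a b - b * a b') ∈ Y := by
    intro b hb b' hb'
    have hb1 := hab b hb
    have hb2 := hab b' hb'
    have hdeg : b' * a b - b * a b' ∈ 𝒜 (d b' + e b) := by
      refine sub_mem (SetLike.mul_mem_graded hb2.den_deg hb1.num_deg) ?_
      have h0 : d b' + e b = d b + e b' := by have := hb1.deg; have := hb2.deg; omega
      rw [h0]
      exact SetLike.mul_mem_graded hb1.den_deg hb2.num_deg
    have hrad : b * b' ∈ (Submodule.colon Y {b' * a b - b * a b'}).radical := by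
      rw [(isHomogeneous_colon hY hdeg).radical_eq, Submodule.mem_sInf]
      rintro Q ⟨hQ, hCQ, hQp⟩
      by_cases hirr : HomogeneousIdeal.irrelevant 𝒜 ≤ ⟨Q, hQ⟩
      · refine Ideal.mul_mem_right _ _ (hirr ?_)
        exact (HomogeneousIdeal.mem_irrelevant_iff 𝒜 b).2
          (DirectSum.decompose_of_mem_ne 𝒜 hb1.den_deg hb1.pos.ne')
      · by_contra hbb
        let q : ProjectiveSpectrum 𝒜 := ⟨⟨Q, hQ⟩, hQp, hirr⟩
        have h1 := hb1.smul_eq q fun h => hbb (Ideal.mul_mem_right _ _ h)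
        have h2 := hb2.smul_eq q fun h => hbb (Ideal.mul_mem_left _ _ h)
        have h3 : toStalk 𝒜 Y q (b' * a b - b * a b') = 0 := by
          rw [map_sub, ← smul_toStalk, ← smul_toStalk, ← h1, ← h2, smul_comm, sub_self]
        obtain ⟨u, hu, huY⟩ := toStalk_eq_zero_iff.1 h3
        exact hu (hCQ (Submodule.mem_colon_singleton.2 huY))
    obtain ⟨k, hk⟩ := hrad
    exact ⟨k, by simpa using Submodule.mem_colon_singleton.1 hk⟩
  choose! k hk using hpow
  -- One exponent for all pairs. Expanding each fraction `a / b` to `b ^ m * a / b ^ (m + 1)` then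
  -- makes its cross differences with the others lie in `Y`, so it is valid even where `b` vanishes.
  set m := ∑ b ∈ T, ∑ b' ∈ T, k b b' with hm
  have hkm : ∀ b ∈ T, ∀ b' ∈ T, (b * b') ^ m * (b' * a b - b * a b') ∈ Y := by
    intro b hb b' hb'
    have hle : k b b' ≤ m :=
      (Finset.single_le_sum (f := fun b' => k b b') (fun _ _ => Nat.zero_le _) hb').trans
        (Finset.single_le_sum (f := fun b => ∑ b' ∈ T, k b b') (fun _ _ => Nat.zero_le _) hb)
    rw [← Nat.sub_add_cancel hle, pow_add, mul_assoc]
    exact Y.mul_mem_left _ (hk b hb b' hb')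
  refine ⟨(fun b => b ^ (m + 1)) '' T, fun q => ?_, ?_⟩
  · obtain ⟨b, hb, hbq⟩ := hcov q
    exact ⟨b ^ (m + 1), ⟨b, hb, rfl⟩, fun h => hbq (q.isPrime.mem_of_pow_mem _ h)⟩
  · rintro _ ⟨b, hb, rfl⟩
    have hb1 := hab b hb
    refine ⟨(m + 1) * d b, m * d b + e b, ?_, ?_, b ^ m * a b, ?_, J.mul_mem_left _ hb1.num_mem,
      fun q => ?_⟩
    · have := hb1.deg; push_cast; linarith
    · simpa using SetLike.pow_mem_graded (m + 1) hb1.den_deg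
    · exact SetLike.mul_mem_graded (by simpa using SetLike.pow_mem_graded m hb1.den_deg)
        hb1.num_deg
    · obtain ⟨b', hb', hbq⟩ := hcov q
      refine Stalk.smul_left_cancel (b := b' ^ (m + 1))
        (fun h => hbq (q.isPrime.mem_of_pow_mem _ h)) ?_
      have h2 := (hab b' hb').smul_eq q hbq
      rw [smul_comm, pow_succ b', mul_smul, h2]
      simp only [smul_toStalk]
      refine toStalk_eq_of_sub_mem ?_
      have := neg_mem (hkm b hb b' hb')
      convert this using 1
      ring

/-- A section of the twisted sheaf of `(J + Y) / Y` becomes a global form in `J` after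
multiplication with any form of large degree. -/
theorem exists_global_numerator [IsNoetherianRing R] (hY : Y.IsHomogeneous 𝒜) {t : ℤ}
    {s : ∀ q : ProjectiveSpectrum 𝒜, Stalk 𝒜 Y q} (hs : s ∈ sections 𝒜 Y J t) :
    ∃ k : ℕ, ∀ d e : ℕ, (e : ℤ) = d + t → ∀ c ∈ (HomogeneousIdeal.irrelevant 𝒜).toIdeal ^ k,
      c ∈ 𝒜 d → ∃ a ∈ 𝒜 e, a ∈ J ∧ ∀ q, c • s q = toStalk 𝒜 Y q a := by
  obtain ⟨B, hcov, hB⟩ := exists_global_denominators hY hs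
  have hhom : (Ideal.span B).IsHomogeneous 𝒜 :=
    Ideal.homogeneous_span 𝒜 B fun b hb => by
      obtain ⟨d, _, _, h, _⟩ := hB b hb
      exact ⟨d, h⟩
  obtain ⟨k, hk⟩ := Ideal.exists_pow_le_of_le_radical_of_fg
    (irrelevant_le_radical hhom fun q => by
      obtain ⟨b, hb, hbq⟩ := hcov q
      exact ⟨b, Ideal.subset_span hb, hbq⟩) (IsNoetherian.noetherian _)
  refine ⟨k, fun d e hde c hck hcd => ?_⟩
  -- The coefficients in a combination of elements of `B` need not be homogeneous, so the claim is
  -- made for the component of degree `d`.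
  have key : ∀ c ∈ Ideal.span B, ∃ a ∈ 𝒜 e, a ∈ J ∧
      ∀ q, (DirectSum.decompose 𝒜 c d : R) • s q = toStalk 𝒜 Y q a := by
    intro c hc
    induction hc using Submodule.closure_induction with
    | zero => exact ⟨0, zero_mem _, zero_mem _, fun q => by simp⟩
    | add x y _ _ hx hy =>
      obtain ⟨a, ha, haJ, hax⟩ := hx
      obtain ⟨a', ha', haJ', hay⟩ := hy
      refine ⟨a + a', add_mem ha ha', add_mem haJ haJ', fun q => ?_⟩
      rw [DirectSum.decompose_add, DirectSum.add_apply, Submodule.coe_add, add_smul, hax, hay,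
        map_add]
    | smul_mem r b hb =>
      obtain ⟨d', e', hde', hbd, a, ha, haJ, hab⟩ := hB b hb
      rw [smul_eq_mul]
      by_cases hle : d' ≤ d
      · obtain ⟨i, rfl⟩ := Nat.exists_eq_add_of_le' hle
        refine ⟨(DirectSum.decompose 𝒜 r i : R) * a, ?_, J.mul_mem_left _ haJ, fun q => ?_⟩
        · have h0 : e = i + e' := by push_cast at hde; omega
          rw [h0]
          exact SetLike.mul_mem_graded (SetLike.coe_mem _) ha
        · rw [DirectSum.coe_decompose_mul_add_of_right_mem 𝒜 hbd, mul_smul, hab, smul_toStalk]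
      · refine ⟨0, zero_mem _, zero_mem _, fun q => ?_⟩
        rw [DirectSum.coe_decompose_mul_of_right_mem_of_not_le 𝒜 hbd hle, zero_smul, map_zero]
  simpa only [DirectSum.decompose_of_mem_same 𝒜 hcd] using key c (hk hck)

end Graded

/-! ### Global sections as forms, and the degree of a zero-dimensional scheme. -/

section Graded

variable {K R : Type*} [Field K] [CommRing R] [Algebra K R]
variable (𝒜 : ℕ → Submodule K R)

/-- The graded piece of degree `t ∈ ℤ`, which is zero for `t < 0`. -/
def gradedPiece (t : ℤ) : Submodule K R := if 0 ≤ t then 𝒜 t.toNat else ⊥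

variable {𝒜}

theorem gradedPiece_natCast (d : ℕ) : gradedPiece 𝒜 d = 𝒜 d := by
  simp [gradedPiece]

theorem gradedPiece_of_neg {t : ℤ} (ht : t < 0) : gradedPiece 𝒜 t = ⊥ :=
  if_neg (not_le.2 ht)

theorem mem_gradedPiece_of_mem {d : ℕ} {t : ℤ} (h : (d : ℤ) = t) {a : R} (ha : a ∈ 𝒜 d) :
    a ∈ gradedPiece 𝒜 t := by
  subst h
  rwa [gradedPiece_natCast]

theorem mem_of_mem_gradedPiece {d : ℕ} {t : ℤ} (h : (d : ℤ) = t) {a : R}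
    (ha : a ∈ gradedPiece 𝒜 t) : a ∈ 𝒜 d := by
  subst h
  rwa [gradedPiece_natCast] at ha

instance [∀ d, FiniteDimensional K (𝒜 d)] (t : ℤ) :
    FiniteDimensional K (gradedPiece 𝒜 t) := by
  by_cases ht : t < 0
  · rw [gradedPiece_of_neg ht]
    infer_instance
  · lift t to ℕ using not_lt.1 ht
    rw [gradedPiece_natCast]
    infer_instance

variable [GradedAlgebra 𝒜]

theorem mul_mem_gradedPiece {d : ℕ} {t u : ℤ} (hu : d + t = u) {a f : R} (ha : a ∈ 𝒜 d)
    (hf : f ∈ gradedPiece 𝒜 t) : a * f ∈ gradedPiece 𝒜 u := by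
  by_cases ht : t < 0
  · rw [gradedPiece_of_neg ht, Submodule.mem_bot] at hf
    rw [hf, mul_zero]
    exact zero_mem _
  · lift t to ℕ using not_lt.1 ht
    rw [gradedPiece_natCast] at hf
    exact mem_gradedPiece_of_mem (d := d + t) (by push_cast; exact hu)
      (SetLike.mul_mem_graded ha hf)

/-- Allows division by a form without assuming `t ≥ 0`: for negative `t` the degree `e` is below `m`
and the component vanishes. -/
theorem exists_gradedPiece_component {m e : ℕ} {t : ℤ} (he : (e : ℤ) = m + t) {b : R}
    (hb : b ∈ 𝒜 m) (g : R) :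
    ∃ f ∈ gradedPiece 𝒜 t, (DirectSum.decompose 𝒜 (b * g) e : R) = b * f := by
  by_cases ht : t < 0
  · refine ⟨0, zero_mem _, ?_⟩
    rw [DirectSum.coe_decompose_mul_of_left_mem_of_not_le 𝒜 hb (by omega), mul_zero]
  · lift t to ℕ using not_lt.1 ht
    obtain rfl : e = m + t := by omega
    refine ⟨DirectSum.decompose 𝒜 g t, ?_, DirectSum.coe_decompose_mul_add_of_left_mem 𝒜 hb⟩
    rw [gradedPiece_natCast]
    exact SetLike.coe_mem _

theorem mem_gradedPiece_of_mul_mem [IsDomain R] {d : ℕ} {t u : ℤ} (hu : d + t = u) {a f : R}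
    (ha : a ∈ 𝒜 d) (ha0 : a ≠ 0) (hf : a * f ∈ gradedPiece 𝒜 u) : f ∈ gradedPiece 𝒜 t := by
  by_cases hu0 : u < 0
  · rw [gradedPiece_of_neg hu0, Submodule.mem_bot] at hf
    rw [(mul_eq_zero.1 hf).resolve_left ha0]
    exact zero_mem _
  · lift u to ℕ using not_lt.1 hu0
    rw [gradedPiece_natCast] at hf
    obtain ⟨f', hf', h⟩ := exists_gradedPiece_component (e := u) hu.symm ha f
    rw [DirectSum.decompose_of_mem_same 𝒜 hf] at h
    rwa [mul_left_cancel₀ ha0 h]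

variable (𝒜) in
/-- The map which sends a form to the family of its germs. -/
def germs (Y : Ideal R) : R →ₗ[K] ∀ q : ProjectiveSpectrum 𝒜, Stalk 𝒜 Y q :=
  LinearMap.pi fun q => (toStalk 𝒜 Y q).restrictScalars K

variable {Y J : Ideal R}

@[simp]
theorem germs_apply (f : R) (q : ProjectiveSpectrum 𝒜) : germs 𝒜 Y f q = toStalk 𝒜 Y q f := rfl

theorem mem_irrelevant_of_mem {d : ℕ} (hd : 0 < d) {a : R} (ha : a ∈ 𝒜 d) :
    a ∈ (HomogeneousIdeal.irrelevant 𝒜).toIdeal :=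
  (HomogeneousIdeal.mem_irrelevant_iff 𝒜 a).2 (DirectSum.decompose_of_mem_ne 𝒜 ha hd.ne')

theorem mem_of_pow_mul_mem {G : R} (hG : ∀ f, G * f ∈ Y → f ∈ Y) (k : ℕ) {f : R}
    (h : G ^ k * f ∈ Y) : f ∈ Y := by
  induction k with
  | zero => simpa using h
  | succ k ih => exact ih (hG _ (by rwa [← mul_assoc, ← pow_succ']))

/-- If all germs vanish, the homogeneous ideal `Y : f` has no zeros, so it contains a power of `G`;
regularity of `G` modulo `Y` cancels it. -/
theorem germs_eq_zero_iff (hY : Y.IsHomogeneous 𝒜) {d : ℕ} (hd : 0 < d) {G : R} (hGd : G ∈ 𝒜 d)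
    (hG : ∀ f, G * f ∈ Y → f ∈ Y) {t : ℤ} {f : R} (hf : f ∈ gradedPiece 𝒜 t) :
    germs 𝒜 Y f = 0 ↔ f ∈ Y := by
  refine ⟨fun h => ?_, fun h => funext fun q => toStalk_of_mem h⟩
  by_cases ht : t < 0
  · rw [gradedPiece_of_neg ht, Submodule.mem_bot] at hf
    rw [hf]
    exact zero_mem _
  · lift t to ℕ using not_lt.1 ht
    rw [gradedPiece_natCast] at hf
    have hrad := irrelevant_le_radical (isHomogeneous_colon hY hf) fun q => by
      obtain ⟨u, hu, huY⟩ := toStalk_eq_zero_iff.1 (congrFun h q)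
      exact ⟨u, Submodule.mem_colon_singleton.2 huY, hu⟩
    obtain ⟨k, hk⟩ := hrad (mem_irrelevant_of_mem hd hGd)
    exact mem_of_pow_mul_mem hG k (Submodule.mem_colon_singleton.1 hk)

/-- Off the zeros of `ℓ` take `ℓ ^ k`. On them `J` has no zero, by the radical hypothesis, so some
form in `J` works. -/
theorem exists_homogeneous_denominator (hJY : J.IsHomogeneous 𝒜) {ℓ : R} {d : ℕ}
    (hℓ : ℓ ∈ 𝒜 d) (hrad : (HomogeneousIdeal.irrelevant 𝒜).toIdeal ≤ (J ⊔ Ideal.span {ℓ}).radical)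
    {f : R} {k : ℕ} (hk : ℓ ^ k * f ∈ J) (p : ProjectiveSpectrum 𝒜) :
    ∃ d, ∃ b ∈ 𝒜 d, b ∉ p.asHomogeneousIdeal.toIdeal ∧ b * f ∈ J := by
  by_cases hp : ℓ ∈ p.asHomogeneousIdeal.toIdeal
  · have hJp : ¬ J ≤ p.asHomogeneousIdeal.toIdeal := by
      intro hle
      refine p.not_irrelevant_le fun x hx => ?_
      obtain ⟨n, hn⟩ := hrad hx
      refine p.isPrime.mem_of_pow_mem n ((sup_le hle ?_ : _ ≤ p.asHomogeneousIdeal.toIdeal) hn)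
      rwa [Ideal.span_singleton_le_iff_mem]
    obtain ⟨z, hz, hzp⟩ := Set.not_subset.1 hJp
    obtain ⟨i, hi⟩ := exists_component_notMem hzp
    exact ⟨i, _, SetLike.coe_mem _, hi, J.mul_mem_right _ (hJY i hz)⟩
  · exact ⟨k • d, ℓ ^ k, SetLike.pow_mem_graded k hℓ, fun h => hp (p.isPrime.mem_of_pow_mem _ h),
      hk⟩

/-- If `R / Y` has depth at least two, then the sections of the twisted sheaf of `(J + Y) / Y` are
the forms in the saturation of `J + Y`. -/
theorem sections_eq_map [IsNoetherianRing R] (hY : Y.IsHomogeneous 𝒜) (hJ : J.IsHomogeneous 𝒜)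
    {G H ℓ : R} (hGd : G ∈ 𝒜 1) (hHd : H ∈ 𝒜 1) (hℓd : ℓ ∈ 𝒜 1)
    (hG : ∀ f, G * f ∈ Y → f ∈ Y)
    (hGH : ∀ k f, H ^ k * f ∈ Y ⊔ Ideal.span {G ^ k} → f ∈ Y ⊔ Ideal.span {G ^ k})
    (hrad : (HomogeneousIdeal.irrelevant 𝒜).toIdeal ≤ (J ⊔ Y ⊔ Ideal.span {ℓ}).radical)
    {Q : Submodule K R} (hQ : ∀ f, f ∈ Q ↔ ∃ k, ℓ ^ k * f ∈ J ⊔ Y) (t : ℤ) :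
    sections 𝒜 Y J t = (gradedPiece 𝒜 t ⊓ Q).map (germs 𝒜 Y) := by
  apply le_antisymm
  · intro s hs
    obtain ⟨k, hk⟩ := exists_global_numerator hY hs
    have hpow : ∀ (d : ℕ) (c : R), 0 < d → c ∈ 𝒜 d → ∃ e : ℕ, (e : ℤ) = (k + t.natAbs) * d + t ∧
        ∃ a ∈ 𝒜 e, a ∈ J ∧ ∀ q, c ^ (k + t.natAbs) • s q = toStalk 𝒜 Y q a := by
      intro d c hd hc
      have hnn : (0 : ℤ) ≤ (k + t.natAbs) * d + t := by
        have h1 : k + t.natAbs ≤ (k + t.natAbs) * d := Nat.le_mul_of_pos_right _ hd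
        zify at h1
        have := neg_abs_le t
        push_cast
        linarith
      obtain ⟨e, he⟩ := Int.eq_ofNat_of_zero_le hnn
      refine ⟨e, he.symm, hk ((k + t.natAbs) * d) e (by push_cast at he ⊢; linarith) _ ?_ ?_⟩
      · rw [pow_add]
        exact Ideal.mul_mem_right _ _ (Ideal.pow_mem_pow (mem_irrelevant_of_mem hd hc) k)
      · simpa using SetLike.pow_mem_graded (k + t.natAbs) hc
    -- The summand `k` brings `c ^ m` into the required power of the irrelevant ideal; `t.natAbs`
    -- keeps the degree of the numerator nonnegative.
    set m := k + t.natAbs with hm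
    have hcomm : ∀ {c c' a a' : R} {e e' : ℕ}, a ∈ 𝒜 e → a' ∈ 𝒜 e' → ∀ i j : ℕ,
        c ∈ 𝒜 i → c' ∈ 𝒜 j → i + e' = j + e → (∀ q, c • s q = toStalk 𝒜 Y q a) →
        (∀ q, c' • s q = toStalk 𝒜 Y q a') → c' * a - c * a' ∈ Y := by
      intro c c' a a' e e' ha ha' i j hc hc' hij h h'
      have hd : c' * a - c * a' ∈ 𝒜 (j + e) :=
        sub_mem (SetLike.mul_mem_graded hc' ha) (by rw [← hij]; exact SetLike.mul_mem_graded hc ha')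
      refine (germs_eq_zero_iff hY one_pos hGd hG (mem_gradedPiece_of_mem rfl hd)).1 ?_
      funext q
      rw [germs_apply, map_sub, ← smul_toStalk, ← smul_toStalk, ← h, ← h', smul_comm, sub_self]
      rfl
    obtain ⟨e, he, a, ha, haJ, hGa⟩ := hpow 1 G one_pos hGd
    replace he : (e : ℤ) = m + t := by rw [he, hm]; push_cast; ring
    obtain ⟨e', he', a', ha', haJ', hHa⟩ := hpow 1 H one_pos hHd
    replace he' : (e' : ℤ) = m + t := by rw [he', hm]; push_cast; ring
    have hGm : G ^ m ∈ 𝒜 m := by simpa using SetLike.pow_mem_graded m hGd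
    have hHm : H ^ m ∈ 𝒜 m := by simpa using SetLike.pow_mem_graded m hHd
    have h1 := hcomm ha ha' m m hGm hHm (by omega) hGa hHa
    -- Depth two at work: `H ^ m * a ≡ G ^ m * a'` modulo `Y`, and `H ^ m` is regular modulo `Y + (G
    -- ^ m)`. Hence `a ≡ G ^ m * f`, and `f` is the form sought.
    have h2 : a ∈ Y ⊔ Ideal.span {G ^ m} := by
      refine hGH m a ?_
      rw [← sub_add_cancel (H ^ m * a) (G ^ m * a')]
      exact add_mem (Ideal.mem_sup_left h1)
        (Ideal.mem_sup_right (Ideal.mul_mem_right _ _ (Ideal.mem_span_singleton_self _)))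
    obtain ⟨y, hy, z, hz, hyz⟩ := Submodule.mem_sup.1 h2
    obtain ⟨g, rfl⟩ := Ideal.mem_span_singleton'.1 hz
    obtain ⟨f, hf, hgf⟩ := exists_gradedPiece_component (e := e) (t := t) he hGm g
    have h3 : a - G ^ m * f ∈ Y := by
      have : a = (DirectSum.decompose 𝒜 y e : R) + G ^ m * f := by
        rw [← DirectSum.decompose_of_mem_same 𝒜 ha, ← hyz, mul_comm g, DirectSum.decompose_add,
          DirectSum.add_apply, Submodule.coe_add, hgf]
      rw [this, add_sub_cancel_right]
      exact hY e hy
    -- Applied to `ℓ` this puts `f` in the saturation; applied to a form nonzero at `q` it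
    -- identifies the germ of `f` with `s q`.
    have h4 : ∀ (d : ℕ) (c : R), 0 < d → c ∈ 𝒜 d → ∃ a ∈ J, a - c ^ m * f ∈ Y ∧
        ∀ q, c ^ m • s q = toStalk 𝒜 Y q a := by
      intro d c hd hc
      obtain ⟨e₁, he₁, a₁, ha₁, haJ₁, hca⟩ := hpow d c hd hc
      refine ⟨a₁, haJ₁, mem_of_pow_mul_mem hG m ?_, hca⟩
      have hcm : c ^ m ∈ 𝒜 (m * d) := by simpa using SetLike.pow_mem_graded m hc
      have h5 := hcomm ha ha₁ m (m * d) hGm hcm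
        (by zify; rw [he₁, he, hm]; push_cast; ring) hGa hca
      have h6 := sub_mem (Y.mul_mem_left (c ^ m) h3) h5
      convert h6 using 1
      ring
    refine ⟨f, ⟨hf, (hQ f).2 ⟨m, ?_⟩⟩, ?_⟩
    · obtain ⟨a, haJ, haY, -⟩ := h4 1 ℓ one_pos hℓd
      rw [← sub_sub_cancel a (ℓ ^ m * f)]
      exact sub_mem (Ideal.mem_sup_left haJ) (Ideal.mem_sup_right haY)
    · funext q
      obtain ⟨d, hd, x, hx, hxq⟩ := exists_irrelevant_notMem q
      obtain ⟨a, haJ, haY, hxa⟩ := h4 d x hd hx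
      refine Stalk.smul_left_cancel (b := x ^ m) (fun h => hxq (q.isPrime.mem_of_pow_mem _ h)) ?_
      rw [hxa, germs_apply, smul_toStalk]
      exact (toStalk_eq_of_sub_mem haY).symm
  · rintro _ ⟨f, ⟨hf, hfQ⟩, rfl⟩ p
    obtain ⟨k, hk⟩ := (hQ f).1 hfQ
    obtain ⟨d, b, hb, hbp, hbf⟩ := exists_homogeneous_denominator (hJ.sup hY) hℓd hrad hk p
    obtain ⟨d', e', hde', c, hc, hcp⟩ := exists_denominator t p
    have hcb : c * b ∈ 𝒜 (d' + d) := SetLike.mul_mem_graded hc hb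
    have hdeg : c * b * f ∈ 𝒜 (e' + d) :=
      mem_of_mem_gradedPiece (t := (d' + d : ℕ) + t) (by push_cast; omega)
        (mul_mem_gradedPiece rfl hcb hf)
    obtain ⟨a, haJ, y, hyY, hay⟩ := Submodule.mem_sup.1
      (show c * b * f ∈ J ⊔ Y by rw [mul_assoc]; exact Ideal.mul_mem_left _ _ hbf)
    refine ⟨ProjectiveSpectrum.basicOpen 𝒜 (c * b), (ProjectiveSpectrum.basicOpen 𝒜 (c * b)).2,
      fun h => (p.isPrime.mem_or_mem h).elim hcp hbp, d' + d, e' + d, by push_cast; omega,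
      DirectSum.decompose 𝒜 a (e' + d), SetLike.coe_mem _, hJ _ haJ, c * b, hcb,
      fun q hq => ⟨hq, ?_⟩⟩
    refine (Stalk.eq_mk_iff hq).2 ?_
    rw [germs_apply, smul_toStalk]
    refine toStalk_eq_of_sub_mem ?_
    have h := DirectSum.decompose_of_mem_same 𝒜 hdeg
    rw [← hay, DirectSum.decompose_add, DirectSum.add_apply, Submodule.coe_add, hay] at h
    rw [← h, add_sub_cancel_left]
    exact hY _ hyY

theorem smul_stalk_eq_zero {q : ProjectiveSpectrum 𝒜} {u : R} (hu : u ∈ Y) (x : Stalk 𝒜 Y q) :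
    u • x = 0 := by
  revert x
  refine LocalizedModule.induction_on fun a b => ?_
  refine (LocalizedModule.smul'_mk u _ _).trans ?_
  obtain ⟨a, rfl⟩ := Ideal.Quotient.mk_surjective a
  have : u • Ideal.Quotient.mk Y a = 0 :=
    Ideal.Quotient.eq_zero_iff_mem.2 (Y.mul_mem_right a hu)
  rw [this]
  exact LocalizedModule.zero_mk b

theorem stalk_eq_zero {q : ProjectiveSpectrum 𝒜} {u : R} (hu : u ∈ Y)
    (huq : u ∉ q.asHomogeneousIdeal.toIdeal) (x : Stalk 𝒜 Y q) : x = 0 :=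
  Stalk.smul_left_cancel huq (by rw [smul_stalk_eq_zero hu, smul_zero])

/-- The dimension of the space of functions on a zero-dimensional subscheme is the value of its
Hilbert function in large degrees. -/
theorem exists_finrank_schemeSections [IsNoetherianRing R] [∀ d, FiniteDimensional K (𝒜 d)]
    {I : Ideal R} (hI : I.IsHomogeneous 𝒜) {ℓ : R} (hℓd : ℓ ∈ 𝒜 1)
    (hrad : (HomogeneousIdeal.irrelevant 𝒜).toIdeal ≤ (I ⊔ Ideal.span {ℓ}).radical)
    {B : ℕ} (hB : ∀ d, Module.finrank K ((𝒜 d).map (germs 𝒜 I)) ≤ B) :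
    FiniteDimensional K (sections 𝒜 I ⊤ 0) ∧ ∃ d₀, ∀ d ≥ d₀,
      Module.finrank K (sections 𝒜 I ⊤ 0) = Module.finrank K ((𝒜 d).map (germs 𝒜 I)) := by
  classical
  -- The scheme misses the hyperplane `ℓ = 0`, so stalks there vanish and `ℓ` acts invertibly on all
  -- stalks.
  have hvan : ∀ q : ProjectiveSpectrum 𝒜, ℓ ∈ q.asHomogeneousIdeal.toIdeal →
      ∃ i, ∃ u ∈ 𝒜 i, u ∈ I ∧ u ∉ q.asHomogeneousIdeal.toIdeal := by
    intro q hq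
    have hIq : ¬ I ≤ q.asHomogeneousIdeal.toIdeal := by
      intro hle
      refine q.not_irrelevant_le fun x hx => ?_
      obtain ⟨n, hn⟩ := hrad hx
      refine q.isPrime.mem_of_pow_mem n ((sup_le hle ?_ : _ ≤ q.asHomogeneousIdeal.toIdeal) hn)
      rwa [Ideal.span_singleton_le_iff_mem]
    obtain ⟨z, hz, hzp⟩ := Set.not_subset.1 hIq
    obtain ⟨i, hi⟩ := exists_component_notMem hzp
    exact ⟨i, _, SetLike.coe_mem _, hI i hz, hi⟩
  have hℓm : ∀ d, ℓ ^ d ∈ 𝒜 d := fun d => by simpa using SetLike.pow_mem_graded d hℓd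
  have hℓq : ∀ {q : ProjectiveSpectrum 𝒜} (d : ℕ), ℓ ∉ q.asHomogeneousIdeal.toIdeal →
      ℓ ^ d ∉ q.asHomogeneousIdeal.toIdeal :=
    fun {q} d hq h => hq (q.isPrime.mem_of_pow_mem _ h)
  let μ : ℕ → (∀ q : ProjectiveSpectrum 𝒜, Stalk 𝒜 I q) →ₗ[K]
      (∀ q : ProjectiveSpectrum 𝒜, Stalk 𝒜 I q) := fun d =>
    LinearMap.pi fun q => ((LinearMap.lsmul R (Stalk 𝒜 I q) (ℓ ^ d)).restrictScalars K).comp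
      (LinearMap.proj q)
  have hμ : ∀ d s q, μ d s q = ℓ ^ d • s q := fun _ _ _ => rfl
  have hinj : ∀ d, Function.Injective (μ d) := by
    intro d s s' h
    funext q
    by_cases hq : ℓ ∈ q.asHomogeneousIdeal.toIdeal
    · obtain ⟨i, u, -, hu, huq⟩ := hvan q hq
      rw [stalk_eq_zero hu huq (s q), stalk_eq_zero hu huq (s' q)]
    · exact Stalk.smul_left_cancel (hℓq d hq) (congrFun h q)
  -- `U d` consists of the functions `f / ℓ ^ d` with `f` of degree `d`. These spaces increase,
  -- exhaust the sections and have bounded dimension, so they stabilize at the space of all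
  -- sections.
  let U : ℕ → Submodule K (∀ q : ProjectiveSpectrum 𝒜, Stalk 𝒜 I q) := fun d =>
    ((𝒜 d).map (germs 𝒜 I)).comap (μ d)
  have hUmap : ∀ d, (U d).map (μ d) = (𝒜 d).map (germs 𝒜 I) := by
    intro d
    refine Submodule.map_comap_eq_of_le ?_
    rintro _ ⟨f, hf, rfl⟩
    refine ⟨fun q => if hq : ℓ ∈ q.asHomogeneousIdeal.toIdeal then 0 else
      Stalk.mk 𝒜 I q f (ℓ ^ d) (hℓq d hq), ?_⟩
    funext q
    rw [hμ]
    split_ifs with hq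
    · obtain ⟨i, u, -, hu, huq⟩ := hvan q hq
      rw [smul_zero, stalk_eq_zero hu huq (germs 𝒜 I f q)]
    · rw [Stalk.smul_mk, germs_apply]
  have hUe : ∀ d, Nonempty (U d ≃ₗ[K] (𝒜 d).map (germs 𝒜 I)) := fun d => by
    rw [← hUmap d]
    exact ⟨Submodule.equivMapOfInjective (μ d) (hinj d) (U d)⟩
  have hUfin : ∀ d, FiniteDimensional K (U d) := fun d =>
    Module.Finite.equiv (hUe d).some.symm
  have hUrank : ∀ d, Module.finrank K (U d) = Module.finrank K ((𝒜 d).map (germs 𝒜 I)) :=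
    fun d => (hUe d).some.finrank_eq
  have hUmono : Monotone U := by
    refine monotone_nat_of_le_succ fun d x hx => ?_
    obtain ⟨f, hf, hfx⟩ := hx
    refine ⟨ℓ * f, ?_, ?_⟩
    · rw [add_comm]
      exact SetLike.mul_mem_graded hℓd hf
    · funext q
      rw [hμ, pow_succ', mul_smul, ← hμ, ← hfx, germs_apply, germs_apply, smul_toStalk]
  have hUsec : ∀ d, U d ≤ sections 𝒜 I ⊤ 0 := by
    intro d x hx p
    obtain ⟨f, hf, hfx⟩ := hx
    by_cases hp : ℓ ∈ p.asHomogeneousIdeal.toIdeal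
    · obtain ⟨i, u, hui, hu, hup⟩ := hvan p hp
      refine ⟨ProjectiveSpectrum.basicOpen 𝒜 u, (ProjectiveSpectrum.basicOpen 𝒜 u).2, hup, i, i,
        by simp, 0, zero_mem _, trivial, u, hui, fun q hq => ⟨hq, ?_⟩⟩
      exact (stalk_eq_zero hu hq _).trans (stalk_eq_zero hu hq _).symm
    · refine ⟨ProjectiveSpectrum.basicOpen 𝒜 ℓ, (ProjectiveSpectrum.basicOpen 𝒜 ℓ).2, hp, d, d,
        by simp, f, hf, trivial, ℓ ^ d, hℓm d, fun q hq => ⟨hℓq d hq, ?_⟩⟩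
      rw [Stalk.eq_mk_iff, ← hμ, ← hfx, germs_apply]
  have hsecU : ∀ s ∈ sections 𝒜 I ⊤ 0, ∃ d, s ∈ U d := by
    intro s hs
    obtain ⟨k, hk⟩ := exists_global_numerator hI hs
    obtain ⟨a, ha, -, hsa⟩ := hk k k (by simp) (ℓ ^ k)
      (Ideal.pow_mem_pow (mem_irrelevant_of_mem one_pos hℓd) k) (hℓm k)
    exact ⟨k, a, ha, funext fun q => (hsa q).symm⟩
  obtain ⟨d₀, hd₀⟩ : ∃ d₀, ∀ d, Module.finrank K (U d) ≤ Module.finrank K (U d₀) := by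
    have hbdd : BddAbove (Set.range fun d => Module.finrank K (U d)) :=
      ⟨B, by rintro _ ⟨d, rfl⟩; exact (hUrank d).trans_le (hB d)⟩
    obtain ⟨d₀, hd₀⟩ := Nat.sSup_mem (Set.range_nonempty _) hbdd
    exact ⟨d₀, fun d => (le_csSup hbdd ⟨d, rfl⟩).trans_eq hd₀.symm⟩
  have hstab : ∀ d ≥ d₀, U d = U d₀ := fun d hd =>
    (Submodule.eq_of_le_of_finrank_le (hUmono hd) (hd₀ d)).symm
  have hall : ∀ d ≥ d₀, sections 𝒜 I ⊤ 0 = U d := by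
    intro d hd
    refine le_antisymm (fun s hs => ?_) (hUsec d)
    obtain ⟨d', hd'⟩ := hsecU s hs
    rw [hstab d hd, ← hstab (max d' d₀) (le_max_right _ _)]
    exact hUmono (le_max_left _ _) hd'
  refine ⟨by rw [hall d₀ le_rfl]; infer_instance, d₀, fun d hd => ?_⟩
  rw [hall d hd, hUrank]

end Graded

theorem finrank_map_add_finrank_inf_ker {K V W : Type*} [Field K] [AddCommGroup V] [Module K V]
    [AddCommGroup W] [Module K W] (P : Submodule K V) [FiniteDimensional K P] (φ : V →ₗ[K] W) :
    Module.finrank K (P.map φ) + Module.finrank K (P ⊓ LinearMap.ker φ : Submodule K V) =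
      Module.finrank K P := by
  have h := LinearMap.finrank_range_add_finrank_ker (φ.domRestrict P)
  rw [LinearMap.range_domRestrict] at h
  rw [← h, LinearMap.ker_domRestrict, ← Submodule.map_comap_subtype]
  congr 1
  exact (Submodule.equivMapOfInjective P.subtype P.injective_subtype _).symm.finrank_eq

/-! ### Hilbert functions of ideals, residuals and hypersurface sections. -/

section Graded

variable {K R : Type*} [Field K] [CommRing R] [Algebra K R]
variable (𝒜 : ℕ → Submodule K R)

/-- The forms of degree `t ∈ ℤ` in the ideal `I`. -/
def idealPiece (I : Ideal R) (t : ℤ) : Submodule K R := gradedPiece 𝒜 t ⊓ I.restrictScalars K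

/-- The dimension of the space of forms of degree `t ∈ ℤ` in the ideal `I`. -/
def idealDim (I : Ideal R) (t : ℤ) : ℤ := Module.finrank K (idealPiece 𝒜 I t)

variable {𝒜} {I J Y : Ideal R} {t u : ℤ}

theorem mem_idealPiece {f : R} : f ∈ idealPiece 𝒜 I t ↔ f ∈ gradedPiece 𝒜 t ∧ f ∈ I := Iff.rfl

theorem idealPiece_top : idealPiece 𝒜 (⊤ : Ideal R) t = gradedPiece 𝒜 t := by
  ext f
  simp [mem_idealPiece]

theorem idealDim_top : idealDim 𝒜 (⊤ : Ideal R) t = Module.finrank K (gradedPiece 𝒜 t) := by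
  rw [idealDim, idealPiece_top]

theorem finrank_map_mulLeft [IsDomain R] {F : R} (hF : F ≠ 0) (P : Submodule K R) :
    Module.finrank K (P.map (LinearMap.mulLeft K F)) = Module.finrank K P :=
  (Submodule.equivMapOfInjective (LinearMap.mulLeft K F)
    (mul_right_injective₀ hF) P).symm.finrank_eq

section

variable [GradedAlgebra 𝒜]

theorem idealPiece_sup_span (hI : I.IsHomogeneous 𝒜) {d : ℕ} (hu : d + t = u) {F : R}
    (hF : F ∈ 𝒜 d) :
    idealPiece 𝒜 (I ⊔ Ideal.span {F}) u =
      idealPiece 𝒜 I u ⊔ (gradedPiece 𝒜 t).map (LinearMap.mulLeft K F) := by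
  apply le_antisymm
  · rintro f ⟨hfu, hf⟩
    by_cases hu0 : u < 0
    · rw [gradedPiece_of_neg hu0] at hfu
      rw [(Submodule.mem_bot K).1 hfu]
      exact zero_mem _
    · lift u to ℕ using not_lt.1 hu0
      replace hfu : f ∈ 𝒜 u := mem_of_mem_gradedPiece rfl hfu
      obtain ⟨a, ha, b, hb, hab⟩ := Submodule.mem_sup.1 hf
      obtain ⟨g, rfl⟩ := Ideal.mem_span_singleton'.1 hb
      obtain ⟨f', hf', hgf⟩ := exists_gradedPiece_component (e := u) (t := t) hu.symm hF g
      have h := DirectSum.decompose_of_mem_same 𝒜 hfu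
      rw [← hab, DirectSum.decompose_add, DirectSum.add_apply, Submodule.coe_add, mul_comm g, hgf,
        mul_comm F g, hab] at h
      rw [← h]
      refine add_mem (Submodule.mem_sup_left ⟨mem_gradedPiece_of_mem rfl (SetLike.coe_mem _),
        hI u ha⟩) (Submodule.mem_sup_right ⟨f', hf', rfl⟩)
  · refine sup_le (fun f hf => ⟨hf.1, Ideal.mem_sup_left hf.2⟩) ?_
    rintro _ ⟨f, hf, rfl⟩
    exact ⟨mul_mem_gradedPiece hu hF hf,
      Ideal.mem_sup_right (Ideal.mul_mem_right _ _ (Ideal.mem_span_singleton_self F))⟩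

theorem idealPiece_inf_map {d : ℕ} (hu : d + t = u) {F : R} (hF : F ∈ 𝒜 d) :
    idealPiece 𝒜 I u ⊓ (gradedPiece 𝒜 t).map (LinearMap.mulLeft K F) =
      (idealPiece 𝒜 (Submodule.colon I {F}) t).map (LinearMap.mulLeft K F) := by
  ext f
  constructor
  · rintro ⟨hf, g, hg, rfl⟩
    refine ⟨g, ⟨hg, ?_⟩, rfl⟩
    refine Submodule.mem_colon_singleton.2 ?_
    rw [smul_eq_mul, mul_comm]
    exact hf.2
  · rintro ⟨g, ⟨hg, hgI⟩, rfl⟩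
    refine ⟨⟨mul_mem_gradedPiece hu hF hg, ?_⟩, g, hg, rfl⟩
    have := Submodule.mem_colon_singleton.1 hgI
    rwa [smul_eq_mul, mul_comm] at this

end

variable [∀ d, FiniteDimensional K (𝒜 d)]

instance : FiniteDimensional K (idealPiece 𝒜 I t) :=
  Submodule.finiteDimensional_of_le (inf_le_left : _ ≤ gradedPiece 𝒜 t)

theorem idealDim_mono (h : I ≤ J) : idealDim 𝒜 I t ≤ idealDim 𝒜 J t :=
  Nat.cast_le.2 (Submodule.finrank_mono fun _ hf => ⟨hf.1, h hf.2⟩)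

theorem idealDim_le_top : idealDim 𝒜 I t ≤ idealDim 𝒜 ⊤ t := idealDim_mono le_top

variable [GradedAlgebra 𝒜] [IsDomain R]

/-- The Hilbert function of the ideal of a section with a hypersurface. -/
theorem idealDim_sup_span (hI : I.IsHomogeneous 𝒜) {d : ℕ} (hu : d + t = u) {F : R}
    (hF : F ∈ 𝒜 d) (hF0 : F ≠ 0) :
    idealDim 𝒜 (I ⊔ Ideal.span {F}) u =
      idealDim 𝒜 I u + idealDim 𝒜 ⊤ t - idealDim 𝒜 (Submodule.colon I {F}) t := by
  -- Inclusion–exclusion for `I_u` and `F · R_t`, whose intersection is `F · (I : F)_t`.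
  have h := Submodule.finrank_sup_add_finrank_inf_eq (idealPiece 𝒜 I u)
    ((gradedPiece 𝒜 t).map (LinearMap.mulLeft K F))
  rw [idealPiece_inf_map hu hF, ← idealPiece_sup_span hI hu hF, finrank_map_mulLeft hF0,
    finrank_map_mulLeft hF0] at h
  rw [idealDim_top]
  simp only [idealDim]
  omega

theorem idealDim_colon_le {d : ℕ} (hu : d + t = u) {F : R} (hF : F ∈ 𝒜 d) (hF0 : F ≠ 0) :
    idealDim 𝒜 (Submodule.colon I {F}) t ≤ idealDim 𝒜 I u := by
  unfold idealDim
  rw [← finrank_map_mulLeft hF0, ← idealPiece_inf_map hu hF]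
  exact Nat.cast_le.2 (Submodule.finrank_mono inf_le_left)

variable (𝒜) in
/-- `I` is the saturated ideal of a zero-dimensional (or empty) closed subscheme, with coordinate
ring `R / I` in which the linear form `ℓ` is regular. -/
structure IsZeroDimensional (I : Ideal R) (ℓ : R) : Prop where
  homogeneous : I.IsHomogeneous 𝒜
  linear : ℓ ∈ 𝒜 1
  ne_zero : ℓ ≠ 0
  regular : ∀ f, ℓ * f ∈ I → f ∈ I
  bounded : ∃ B : ℤ, ∀ t : ℤ, idealDim 𝒜 ⊤ t ≤ idealDim 𝒜 I t + B

namespace IsZeroDimensional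

variable {ℓ F : R}

theorem colon (h : IsZeroDimensional 𝒜 I ℓ) {d : ℕ} (hF : F ∈ 𝒜 d) :
    IsZeroDimensional 𝒜 (Submodule.colon I {F}) ℓ where
  homogeneous := isHomogeneous_colon h.homogeneous hF
  linear := h.linear
  ne_zero := h.ne_zero
  regular f hf := by
    rw [Submodule.mem_colon_singleton, smul_eq_mul] at hf ⊢
    exact h.regular _ (by rwa [← mul_assoc])
  bounded := by
    obtain ⟨B, hB⟩ := h.bounded
    exact ⟨B, fun t => (hB t).trans (by gcongr; exact idealDim_mono Ideal.le_colon)⟩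

theorem pow_mem (h : IsZeroDimensional 𝒜 I ℓ) (k : ℕ) : ℓ ^ k ∈ 𝒜 k := by
  simpa using SetLike.pow_mem_graded k h.linear

theorem colon_pow (h : IsZeroDimensional 𝒜 I ℓ) (k : ℕ) : Submodule.colon I {ℓ ^ k} = I := by
  refine le_antisymm (fun f hf => ?_) Ideal.le_colon
  rw [Submodule.mem_colon_singleton, smul_eq_mul, mul_comm] at hf
  exact mem_of_pow_mul_mem h.regular k hf

theorem idealDim_sup_pow (h : IsZeroDimensional 𝒜 I ℓ) (k : ℕ) (hu : k + t = u) :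
    idealDim 𝒜 (I ⊔ Ideal.span {ℓ ^ k}) u =
      idealDim 𝒜 I u + idealDim 𝒜 ⊤ t - idealDim 𝒜 I t := by
  rw [idealDim_sup_span h.homogeneous hu (h.pow_mem k) (pow_ne_zero _ h.ne_zero), h.colon_pow]

theorem hilbert_le_succ (h : IsZeroDimensional 𝒜 I ℓ) (t : ℤ) :
    idealDim 𝒜 ⊤ t - idealDim 𝒜 I t ≤ idealDim 𝒜 ⊤ (t + 1) - idealDim 𝒜 I (t + 1) := by
  have h1 := h.idealDim_sup_pow (t := t) (u := t + 1) 1 (by push_cast; ring)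
  have h2 := idealDim_le_top (𝒜 := 𝒜) (I := I ⊔ Ideal.span {ℓ ^ 1}) (t := t + 1)
  linarith

theorem hilbert_mono (h : IsZeroDimensional 𝒜 I ℓ) :
    Monotone fun t : ℤ => idealDim 𝒜 ⊤ t - idealDim 𝒜 I t :=
  monotone_int_of_le_succ h.hilbert_le_succ

theorem exists_hilbert_eq (h : IsZeroDimensional 𝒜 I ℓ) :
    ∃ d₀ : ℕ, ∀ t : ℤ, d₀ ≤ t →
      idealDim 𝒜 ⊤ t - idealDim 𝒜 I t = idealDim 𝒜 ⊤ d₀ - idealDim 𝒜 I d₀ := by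
  obtain ⟨B, hB⟩ := h.bounded
  have hbdd : BddAbove (Set.range fun d : ℕ => (idealDim 𝒜 ⊤ d - idealDim 𝒜 I d : ℤ)) :=
    ⟨B, by rintro _ ⟨d, rfl⟩; have := hB d; simp only; linarith⟩
  obtain ⟨d₀, hd₀⟩ := Int.csSup_mem (Set.range_nonempty _) hbdd
  refine ⟨d₀, fun t ht => le_antisymm ?_ (h.hilbert_mono ht)⟩
  lift t to ℕ using (Int.natCast_nonneg d₀).trans ht
  exact (le_csSup hbdd ⟨t, rfl⟩).trans_eq hd₀.symm

/-- Growth of the Hilbert function of `R / I` from `t` to `t + 1` is the codimension of `I + (ℓ)` in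
degree `t + 1`. Once the function is constant, `I + (ℓ)` contains all forms of that degree. -/
theorem irrelevant_le_radical (h : IsZeroDimensional 𝒜 I ℓ) :
    (HomogeneousIdeal.irrelevant 𝒜).toIdeal ≤ (I ⊔ Ideal.span {ℓ}).radical := by
  classical
  obtain ⟨d₀, hd₀⟩ := h.exists_hilbert_eq
  have hle : ∀ d : ℕ, d₀ ≤ d → ∀ x ∈ 𝒜 (d + 1), x ∈ I ⊔ Ideal.span {ℓ} := by
    intro d hd x hx
    have h1 := h.idealDim_sup_pow (t := d) 1 rfl
    have h2 := hd₀ d (by exact_mod_cast hd)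
    have h3 := hd₀ ((1 : ℕ) + d) (by push_cast; omega)
    have h4 : idealPiece 𝒜 (I ⊔ Ideal.span {ℓ ^ 1}) ((1 : ℕ) + d) =
        idealPiece 𝒜 ⊤ ((1 : ℕ) + d) := by
      refine Submodule.eq_of_le_of_finrank_eq (fun f hf => ⟨hf.1, trivial⟩) ?_
      simp only [idealDim] at h1 h2 h3
      omega
    have h5 : x ∈ idealPiece 𝒜 (⊤ : Ideal R) ((1 : ℕ) + d) :=
      ⟨mem_gradedPiece_of_mem (d := d + 1) (by push_cast; ring) hx, trivial⟩
    rw [← h4, pow_one] at h5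
    exact h5.2
  intro x hx
  have hx0 := (HomogeneousIdeal.mem_irrelevant_iff 𝒜 x).1 hx
  rw [← DirectSum.sum_support_decompose 𝒜 x]
  refine Ideal.sum_mem _ fun i _ => ?_
  rcases Nat.eq_zero_or_pos i with rfl | hi
  · have : (DirectSum.decompose 𝒜 x 0 : R) = 0 := hx0
    rw [this]
    exact zero_mem _
  · refine ⟨d₀ + 1, ?_⟩
    obtain ⟨d, hd⟩ : ∃ d, (d₀ + 1) * i = d + 1 ∧ d₀ ≤ d :=
      ⟨(d₀ + 1) * i - 1, by
        have : d₀ + 1 ≤ (d₀ + 1) * i := Nat.le_mul_of_pos_right _ hi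
        omega⟩
    refine hle d hd.2 _ ?_
    rw [← hd.1]
    exact SetLike.pow_mem_graded (d₀ + 1) (SetLike.coe_mem (DirectSum.decompose 𝒜 x i))

/-- Without zeros, `I` contains a power of `ℓ`; as `ℓ` is regular modulo `I`, it contains `1`. -/
theorem eq_top_of_zeroLocus_eq_empty (h : IsZeroDimensional 𝒜 I ℓ)
    (hI : ProjectiveSpectrum.zeroLocus 𝒜 (I : Set R) = ∅) : I = ⊤ := by
  have hrad := FatPoints.irrelevant_le_radical h.homogeneous fun q => by
    have hq : q ∉ ProjectiveSpectrum.zeroLocus 𝒜 (I : Set R) := by rw [hI]; exact id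
    exact Set.not_subset.1 hq
  obtain ⟨k, hk⟩ := hrad (mem_irrelevant_of_mem one_pos h.linear)
  rw [Ideal.eq_top_iff_one]
  exact mem_of_pow_mul_mem h.regular k (by simpa using hk)

/-! ### Degrees, saturations and traces in terms of Hilbert functions. -/

section Degree

variable [IsNoetherianRing R]

theorem finrank_map_germs (h : IsZeroDimensional 𝒜 I ℓ) (d : ℕ) :
    (Module.finrank K ((𝒜 d).map (germs 𝒜 I)) : ℤ) = idealDim 𝒜 ⊤ d - idealDim 𝒜 I d := by
  have h1 := finrank_map_add_finrank_inf_ker (𝒜 d) (germs 𝒜 I)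
  have h2 : 𝒜 d ⊓ LinearMap.ker (germs 𝒜 I) = idealPiece 𝒜 I d := by
    ext f
    rw [Submodule.mem_inf, mem_idealPiece, gradedPiece_natCast]
    refine and_congr_right fun hf => ?_
    exact germs_eq_zero_iff h.homogeneous one_pos h.linear h.regular (mem_gradedPiece_of_mem rfl hf)
  rw [h2] at h1
  rw [idealDim_top, gradedPiece_natCast, idealDim]
  omega

theorem schemeSections (h : IsZeroDimensional 𝒜 I ℓ) :
    FiniteDimensional K (sections 𝒜 I ⊤ 0) ∧ ∃ d₀ : ℕ, ∀ t : ℤ, d₀ ≤ t →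
      (Module.finrank K (sections 𝒜 I ⊤ 0) : ℤ) = idealDim 𝒜 ⊤ t - idealDim 𝒜 I t := by
  obtain ⟨B, hB⟩ := h.bounded
  obtain ⟨hfin, d₀, hd₀⟩ := exists_finrank_schemeSections h.homogeneous h.linear
    h.irrelevant_le_radical (B := B.toNat) fun d => by
      have h1 := h.finrank_map_germs d
      have h2 := hB d
      omega
  refine ⟨hfin, d₀, fun t ht => ?_⟩
  lift t to ℕ using (Int.natCast_nonneg d₀).trans ht
  rw [hd₀ t (by exact_mod_cast ht), h.finrank_map_germs]

/-- The chain `J : ℓ ^ k` stabilizes. The last clause makes the saturation a single colon ideal, so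
that `idealDim_sup_span` computes its Hilbert function. -/
theorem exists_saturation (ℓ : R) (J : Ideal R) :
    ∃ Q : Ideal R, (∀ f, f ∈ Q ↔ ∃ k, ℓ ^ k * f ∈ J) ∧
      ∃ k₀, ∀ k ≥ k₀, Q = Submodule.colon J {ℓ ^ k} := by
  have hmono : Monotone fun k => Submodule.colon J {ℓ ^ k} := by
    refine monotone_nat_of_le_succ fun k f hf => ?_
    rw [Submodule.mem_colon_singleton, smul_eq_mul] at hf ⊢
    rw [pow_succ, ← mul_assoc]
    exact J.mul_mem_right _ hf
  obtain ⟨k₀, hk₀⟩ := monotone_stabilizes_iff_noetherian.2 ‹IsNoetherianRing R› ⟨_, hmono⟩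
  refine ⟨Submodule.colon J {ℓ ^ k₀}, fun f => ⟨fun hf => ⟨k₀, ?_⟩, ?_⟩, k₀, hk₀⟩
  · rwa [Submodule.mem_colon_singleton, smul_eq_mul, mul_comm] at hf
  · rintro ⟨k, hk⟩
    have h1 : f ∈ Submodule.colon J {ℓ ^ k} := by
      rwa [Submodule.mem_colon_singleton, smul_eq_mul, mul_comm]
    have h2 : f ∈ Submodule.colon J {ℓ ^ max k k₀} := hmono (le_max_left k k₀) h1
    rwa [← show Submodule.colon J {ℓ ^ k₀} = Submodule.colon J {ℓ ^ max k k₀} from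
      hk₀ _ (le_max_right k k₀)] at h2

variable {Q : Ideal R}

/-- The formula for `I + (F)` is exact; the inequality is the loss in passing to its saturation,
where restriction of sections may fail to be surjective. -/
theorem idealDim_le_saturation (h : IsZeroDimensional 𝒜 I ℓ) (hF : F ∈ 𝒜 1) (hF0 : F ≠ 0)
    (hQ : ∀ f, f ∈ Q ↔ ∃ k, ℓ ^ k * f ∈ I ⊔ Ideal.span {F}) (t : ℤ) :
    idealDim 𝒜 I t ≤ idealDim 𝒜 (Submodule.colon I {F}) (t - 1) +
      (idealDim 𝒜 Q t - idealDim 𝒜 ⊤ (t - 1)) := by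
  have h1 := idealDim_sup_span (t := t - 1) (u := t) h.homogeneous (d := 1) (by push_cast; ring)
    hF hF0
  have h2 : idealDim 𝒜 (I ⊔ Ideal.span {F}) t ≤ idealDim 𝒜 Q t :=
    idealDim_mono fun f hf => (hQ f).2 ⟨0, by simpa using hf⟩
  linarith

/-- Let `k` be large. In degree `k + t`, `I + (F)` exceeds `I` by exactly the degree of the
residual, and `Q_t` enters through `(I + (F)) : ℓ ^ k = Q`. Comparing `I + (F) + (ℓ ^ k)` from below
with `I + (ℓ ^ k)` gives the first inequality, and from above with the whole ring the second. -/
theorem saturation_le_idealDim_add (h : IsZeroDimensional 𝒜 I ℓ) (hF : F ∈ 𝒜 1) (hF0 : F ≠ 0)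
    (hQ : ∀ f, f ∈ Q ↔ ∃ k, ℓ ^ k * f ∈ I ⊔ Ideal.span {F}) (t : ℤ) :
    idealDim 𝒜 Q t ≤ idealDim 𝒜 I t +
        Module.finrank K (sections 𝒜 (Submodule.colon I {F}) ⊤ 0) ∧
      idealDim 𝒜 ⊤ t - Module.finrank K (sections 𝒜 I ⊤ 0) ≤ idealDim 𝒜 Q t -
        Module.finrank K (sections 𝒜 (Submodule.colon I {F}) ⊤ 0) := by
  obtain ⟨Q', hQ', k₀, hk₀⟩ := exists_saturation ℓ (I ⊔ Ideal.span {F})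
  obtain rfl : Q = Q' := by ext f; rw [hQ, hQ']
  have h' := h.colon hF
  obtain ⟨-, d₁, hd₁⟩ := h.schemeSections
  obtain ⟨-, d₂, hd₂⟩ := h'.schemeSections
  obtain ⟨k, hk, hk₁, hk₂⟩ : ∃ k : ℕ, k₀ ≤ k ∧ (d₁ : ℤ) ≤ k + t ∧ (d₂ : ℤ) ≤ k + t - 1 :=
    ⟨k₀ + d₁ + d₂ + t.natAbs + 1, by omega, by omega, by omega⟩
  have hhom : (I ⊔ Ideal.span {F}).IsHomogeneous 𝒜 :=
    h.homogeneous.sup (Ideal.homogeneous_span 𝒜 _ (by rintro _ rfl; exact ⟨1, hF⟩))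
  have e1 := idealDim_sup_span (t := k + t - 1) (u := k + t) h.homogeneous (d := 1)
    (by push_cast; ring) hF hF0
  have e2 := idealDim_sup_span (u := k + t) hhom rfl (h.pow_mem k) (pow_ne_zero _ h.ne_zero)
  have e3 := h.idealDim_sup_pow k (u := k + t) rfl
  have e4 : idealDim 𝒜 (I ⊔ Ideal.span {ℓ ^ k}) (k + t) ≤
      idealDim 𝒜 (I ⊔ Ideal.span {F} ⊔ Ideal.span {ℓ ^ k}) (k + t) :=
    idealDim_mono (sup_le_sup_right le_sup_left _)
  have e5 : idealDim 𝒜 (I ⊔ Ideal.span {F} ⊔ Ideal.span {ℓ ^ k}) (k + t) ≤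
    idealDim 𝒜 ⊤ (k + t) := idealDim_le_top
  rw [← hk₀ k hk] at e2
  have e6 := hd₁ _ hk₁
  have e7 := hd₂ _ hk₂
  constructor <;> linarith

/-- Sections of the twisted ideal sheaf are the forms in the ideal. -/
theorem idealSections (h : IsZeroDimensional 𝒜 I ℓ) {G H : R} (hGd : G ∈ 𝒜 1) (hHd : H ∈ 𝒜 1)
    (hG : G ≠ 0) (hGH : ∀ k f, H ^ k * f ∈ Ideal.span {G ^ k} → f ∈ Ideal.span {G ^ k}) (t : ℤ) :
    FiniteDimensional K (sections 𝒜 ⊥ I t) ∧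
      (Module.finrank K (sections 𝒜 ⊥ I t) : ℤ) = idealDim 𝒜 I t := by
  have hG' : ∀ f, G * f ∈ (⊥ : Ideal R) → f ∈ (⊥ : Ideal R) := fun f hf => by
    simpa [hG] using hf
  have hbot := Ideal.IsHomogeneous.bot 𝒜
  have heq : sections 𝒜 ⊥ I t = (idealPiece 𝒜 I t).map (germs 𝒜 ⊥) :=
    sections_eq_map hbot h.homogeneous hGd hHd h.linear hG'
      (by simpa using hGH) (by simpa using h.irrelevant_le_radical)
      (Q := I.restrictScalars K) (fun f => by
        simp only [sup_bot_eq, Submodule.restrictScalars_mem]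
        exact ⟨fun hf => ⟨0, by simpa using hf⟩, fun ⟨k, hk⟩ => mem_of_pow_mul_mem h.regular k hk⟩) t
  have hker : idealPiece 𝒜 I t ⊓ LinearMap.ker (germs 𝒜 (⊥ : Ideal R)) = ⊥ := by
    rw [Submodule.eq_bot_iff]
    rintro f ⟨hf, hfk⟩
    exact (germs_eq_zero_iff hbot one_pos hGd hG' hf.1).1 hfk
  have hrank := finrank_map_add_finrank_inf_ker (idealPiece 𝒜 I t) (germs 𝒜 (⊥ : Ideal R))
  rw [hker, finrank_bot, add_zero] at hrank
  rw [heq]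
  exact ⟨inferInstance, by rw [hrank]; rfl⟩

/-- Sections of the twisted ideal sheaf of a hyperplane section. -/
theorem traceSections (h : IsZeroDimensional 𝒜 I ℓ) (hF : F ∈ 𝒜 1) (hF0 : F ≠ 0)
    {G H : R} (hGd : G ∈ 𝒜 1) (hHd : H ∈ 𝒜 1)
    (hG : ∀ f, G * f ∈ Ideal.span {F} → f ∈ Ideal.span {F})
    (hGH : ∀ k f, H ^ k * f ∈ Ideal.span {F} ⊔ Ideal.span {G ^ k} →
      f ∈ Ideal.span {F} ⊔ Ideal.span {G ^ k})
    (hQ : ∀ f, f ∈ Q ↔ ∃ k, ℓ ^ k * f ∈ I ⊔ Ideal.span {F}) (t : ℤ) :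
    FiniteDimensional K (sections 𝒜 (Ideal.span {F}) I t) ∧
      (Module.finrank K (sections 𝒜 (Ideal.span {F}) I t) : ℤ) =
        idealDim 𝒜 Q t - idealDim 𝒜 ⊤ (t - 1) := by
  have hhom : (Ideal.span {F}).IsHomogeneous 𝒜 :=
    Ideal.homogeneous_span 𝒜 _ (by rintro _ rfl; exact ⟨1, hF⟩)
  have heq : sections 𝒜 (Ideal.span {F}) I t = (idealPiece 𝒜 Q t).map (germs 𝒜 (Ideal.span {F})) :=
    sections_eq_map hhom h.homogeneous hGd hHd h.linear hG hGH
      (h.irrelevant_le_radical.trans (Ideal.radical_mono (sup_le_sup_right le_sup_left _)))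
      (Q := Q.restrictScalars K) hQ t
  -- A form in `Q` restricts to zero on the hyperplane exactly when it is a multiple of `F`; this
  -- accounts for the subtracted `dim R_{t-1}`.
  have hker : idealPiece 𝒜 Q t ⊓ LinearMap.ker (germs 𝒜 (Ideal.span {F})) =
      (gradedPiece 𝒜 (t - 1)).map (LinearMap.mulLeft K F) := by
    ext f
    constructor
    · rintro ⟨hf, hfk⟩
      have hfF := (germs_eq_zero_iff hhom one_pos hGd hG hf.1).1 hfk
      obtain ⟨g, rfl⟩ := Ideal.mem_span_singleton'.1 hfF
      refine ⟨g, mem_gradedPiece_of_mul_mem (d := 1) (u := t) (by push_cast; ring) hF hF0 ?_,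
        mul_comm F g⟩
      rw [mul_comm]
      exact hf.1
    · rintro ⟨g, hg, rfl⟩
      have hFg : F * g ∈ Ideal.span {F} :=
        Ideal.mul_mem_right _ _ (Ideal.mem_span_singleton_self F)
      have hd := mul_mem_gradedPiece (d := 1) (u := t) (by push_cast; ring) hF hg
      exact ⟨⟨hd, (hQ _).2 ⟨0, by simpa using Ideal.mem_sup_right hFg⟩⟩,
        (germs_eq_zero_iff hhom one_pos hGd hG hd).2 hFg⟩
  have hrank := finrank_map_add_finrank_inf_ker (idealPiece 𝒜 Q t) (germs 𝒜 (Ideal.span {F}))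
  rw [hker, finrank_map_mulLeft hF0] at hrank
  rw [heq]
  refine ⟨inferInstance, ?_⟩
  rw [idealDim_top]
  simp only [idealDim]
  omega

end Degree

end IsZeroDimensional

end Graded

/-! ### Linear coordinates, regular pairs of linear forms and the number of monomials. -/

section Coordinates

open MvPolynomial

variable {K : Type*} [Field K]

instance {σ : Type*} [Finite σ] (d : ℕ) : FiniteDimensional K (homogeneousSubmodule σ K d) :=
  Module.Finite.iff_fg.2 (homogeneousSubmodule_fg σ K d)

/-- The linear form with the given coefficients. -/
def linearForm {σ : Type*} [Fintype σ] (v : σ → K) : MvPolynomial σ K := ∑ j, C (v j) * X j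

section

variable {σ : Type*} [Fintype σ]

theorem linearForm_mem (v : σ → K) : linearForm v ∈ homogeneousSubmodule σ K 1 :=
  sum_mem fun j _ => by
    rw [mem_homogeneousSubmodule]
    simpa using (isHomogeneous_C σ (v j)).mul (isHomogeneous_X K j)

theorem eval_linearForm (v p : σ → K) : eval p (linearForm v) = v ⬝ᵥ p := by
  simp [linearForm, dotProduct]

theorem exists_eq_linearForm {F : MvPolynomial σ K} (hF : F ∈ homogeneousSubmodule σ K 1) :
    ∃ v, F = linearForm v := by
  rw [homogeneousSubmodule_one_eq_span_X, Submodule.mem_span_range_iff_exists_fun] at hF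
  obtain ⟨c, hc⟩ := hF
  exact ⟨c, by simp [linearForm, ← hc, smul_eq_C_mul]⟩

/-- A matrix acts on a polynomial ring by linear substitutions. -/
def substitution (M : Matrix σ σ K) : MvPolynomial σ K →ₐ[K] MvPolynomial σ K :=
  aeval fun i => linearForm (M i)

theorem substitution_comp (M M' : Matrix σ σ K) :
    (substitution M).comp (substitution M') = substitution (M' * M) := by
  ext1 i
  simp only [substitution, AlgHom.comp_apply, aeval_X, linearForm, map_sum, map_mul, aeval_C,
    Matrix.mul_apply, Finset.sum_mul, Finset.mul_sum]
  rw [Finset.sum_comm]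
  simp [algebraMap_eq, mul_assoc]

theorem substitution_one [DecidableEq σ] : substitution (1 : Matrix σ σ K) = AlgHom.id K _ := by
  ext1 i
  simp [substitution, linearForm, Matrix.one_apply]

theorem substitution_mem (M : Matrix σ σ K) {d : ℕ} {f : MvPolynomial σ K}
    (hf : f ∈ homogeneousSubmodule σ K d) : substitution M f ∈ homogeneousSubmodule σ K d := by
  rw [mem_homogeneousSubmodule] at hf ⊢
  have := hf.aeval (fun i => linearForm (M i)) (n := 1) fun i => linearForm_mem (M i)
  rwa [one_mul] at this

end

variable {N : ℕ}

/-- Linear coordinates in which a given linear form is the first coordinate, and all other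
coordinates vanish in a given point. -/
theorem exists_coordinates {v p : Fin (N + 1) → K} (h : v ⬝ᵥ p ≠ 0) :
    ∃ φ : MvPolynomial (Fin (N + 1)) K ≃ₐ[K] MvPolynomial (Fin (N + 1)) K,
      φ (X 0) = linearForm v ∧ (∀ i : Fin N, eval p (φ (X i.succ)) = 0) ∧
      (∀ d, ∀ f ∈ homogeneousSubmodule (Fin (N + 1)) K d,
        φ f ∈ homogeneousSubmodule (Fin (N + 1)) K d) ∧
      (∀ d, ∀ f ∈ homogeneousSubmodule (Fin (N + 1)) K d,
        φ.symm f ∈ homogeneousSubmodule (Fin (N + 1)) K d) := by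
  let e : Module.Dual K (Fin (N + 1) → K) := dotProductBilin K K p
  have he : ∀ w, e w = w ⬝ᵥ p := fun w => dotProduct_comm p w
  have he0 : e ≠ 0 := fun h0 => h (by rw [← he, h0]; rfl)
  have hrank : Module.finrank K (LinearMap.ker e) = N := by
    have := Module.Dual.finrank_ker_add_one_of_ne_zero he0
    rw [Module.finrank_fin_fun] at this
    omega
  let b := Module.finBasisOfFinrankEq K (LinearMap.ker e) hrank
  -- The rows are `v` and a basis of the linear forms vanishing at `p`; they are independent because
  -- `v` does not vanish at `p`.
  let M : Matrix (Fin (N + 1)) (Fin (N + 1)) K :=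
    Fin.cons (α := fun _ => Fin (N + 1) → K) v fun i => (b i : Fin (N + 1) → K)
  have hM : LinearIndependent K M := by
    refine LinearIndependent.finCons ?_ ?_
    · exact b.linearIndependent.map' (LinearMap.ker e).subtype (Submodule.ker_subtype _)
    · intro hv
      have hle : Submodule.span K (Set.range fun i => (b i : Fin (N + 1) → K)) ≤
          LinearMap.ker e := by
        rw [Submodule.span_le]
        rintro _ ⟨i, rfl⟩
        exact (b i).2
      exact h (by rw [← he]; exact hle hv)
  have hu := Matrix.linearIndependent_rows_iff_isUnit.1 hM
  have hdet := (Matrix.isUnit_iff_isUnit_det M).1 hu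
  let φ : MvPolynomial (Fin (N + 1)) K ≃ₐ[K] MvPolynomial (Fin (N + 1)) K :=
    AlgEquiv.ofAlgHom (substitution M) (substitution M⁻¹)
      (by rw [substitution_comp, Matrix.nonsing_inv_mul M hdet, substitution_one])
      (by rw [substitution_comp, Matrix.mul_nonsing_inv M hdet, substitution_one])
  have hφ : ∀ i, φ (X i) = linearForm (M i) := fun i => aeval_X _ i
  refine ⟨φ, hφ 0, fun i => ?_, fun d f hf => substitution_mem M hf,
    fun d f hf => substitution_mem M⁻¹ hf⟩
  rw [hφ, eval_linearForm, ← he]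
  exact (b i).2

/-- A variable is regular modulo the ideals which are generated by monomials in the other
variables. -/
theorem mem_span_monomial_of_X_pow_mul_mem {σ : Type*} {A : Set (σ →₀ ℕ)} {i : σ}
    (hA : ∀ s ∈ A, s i = 0) {k : ℕ} {f : MvPolynomial σ K}
    (hf : X i ^ k * f ∈ Ideal.span ((fun s => monomial s (1 : K)) '' A)) :
    f ∈ Ideal.span ((fun s => monomial s (1 : K)) '' A) := by
  classical
  rw [mem_ideal_span_monomial_image] at hf ⊢
  intro m hm
  obtain ⟨s, hs, hsm⟩ := hf (Finsupp.single i k + m) (by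
    rw [mem_support_iff] at hm ⊢
    rwa [X_pow_eq_monomial, coeff_monomial_mul, one_mul])
  refine ⟨s, hs, fun j => ?_⟩
  by_cases hj : j = i
  · subst hj
    rw [hA s hs]
    exact Nat.zero_le _
  · have := hsm j
    rwa [Finsupp.add_apply, Finsupp.single_eq_of_ne hj, zero_add] at this

theorem X_pow_mul_mem_span_X_pow {σ : Type*} {i j : σ} (hij : i ≠ j) (k l : ℕ)
    {f : MvPolynomial σ K} (hf : X j ^ l * f ∈ Ideal.span {(X i : MvPolynomial σ K) ^ k}) :
    f ∈ Ideal.span {(X i : MvPolynomial σ K) ^ k} := by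
  have h : ({(X i : MvPolynomial σ K) ^ k} : Set (MvPolynomial σ K)) =
      (fun s => monomial s (1 : K)) '' {Finsupp.single i k} := by
    simp [X_pow_eq_monomial]
  rw [h] at hf ⊢
  refine mem_span_monomial_of_X_pow_mul_mem ?_ hf
  rintro _ rfl
  exact Finsupp.single_eq_of_ne hij.symm

theorem X_pow_mul_mem_sup_span_X_pow {σ : Type*} {i i' j : σ} (hij : i ≠ j) (hij' : i' ≠ j)
    (k l : ℕ) {f : MvPolynomial σ K}
    (hf : X j ^ l * f ∈ Ideal.span {(X i : MvPolynomial σ K)} ⊔ Ideal.span {X i' ^ k}) :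
    f ∈ Ideal.span {(X i : MvPolynomial σ K)} ⊔ Ideal.span {X i' ^ k} := by
  have h : Ideal.span {(X i : MvPolynomial σ K)} ⊔ Ideal.span {X i' ^ k} =
      Ideal.span ((fun s => monomial s (1 : K)) '' {Finsupp.single i 1, Finsupp.single i' k}) := by
    rw [← Ideal.span_union, Set.image_pair, X_pow_eq_monomial]
    rfl
  rw [h] at hf ⊢
  refine mem_span_monomial_of_X_pow_mul_mem ?_ hf
  rintro _ (rfl | rfl)
  · exact Finsupp.single_eq_of_ne hij.symm
  · exact Finsupp.single_eq_of_ne hij'.symm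

theorem exists_regular_pair (hN : 1 ≤ N) :
    ∃ G ∈ homogeneousSubmodule (Fin (N + 1)) K 1, ∃ H ∈ homogeneousSubmodule (Fin (N + 1)) K 1,
      G ≠ 0 ∧ ∀ k f, H ^ k * f ∈ Ideal.span {G ^ k} → f ∈ Ideal.span {G ^ k} := by
  have h01 : (⟨0, by omega⟩ : Fin (N + 1)) ≠ ⟨1, by omega⟩ := by simp
  exact ⟨X ⟨0, by omega⟩, isHomogeneous_X K _, X ⟨1, by omega⟩, isHomogeneous_X K _, X_ne_zero _,
    fun k f hf => X_pow_mul_mem_span_X_pow h01 k k hf⟩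

/-- In coordinates with `F = x₀`, the pair `x₁, x₂` works since the ideals involved are monomial;
two further variables need `N ≥ 2`. -/
theorem exists_regular_pair_mod (hN : 2 ≤ N) {F : MvPolynomial (Fin (N + 1)) K}
    (hF : F ∈ homogeneousSubmodule (Fin (N + 1)) K 1) (hF0 : F ≠ 0) :
    ∃ G ∈ homogeneousSubmodule (Fin (N + 1)) K 1, ∃ H ∈ homogeneousSubmodule (Fin (N + 1)) K 1,
      (∀ f, G * f ∈ Ideal.span {F} → f ∈ Ideal.span {F}) ∧
      ∀ k f, H ^ k * f ∈ Ideal.span {F} ⊔ Ideal.span {G ^ k} →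
        f ∈ Ideal.span {F} ⊔ Ideal.span {G ^ k} := by
  obtain ⟨v, rfl⟩ := exists_eq_linearForm hF
  obtain ⟨p, hp⟩ : ∃ p, v ⬝ᵥ p ≠ 0 := by
    by_contra! hcon
    refine hF0 ?_
    rw [dotProduct_eq_zero v hcon]
    simp [linearForm]
  obtain ⟨φ, hφ0, -, hφ, -⟩ := exists_coordinates hp
  let i₁ : Fin (N + 1) := ⟨1, by omega⟩
  let i₂ : Fin (N + 1) := ⟨2, by omega⟩
  have h01 : (0 : Fin (N + 1)) ≠ i₁ := by simp [i₁, Fin.ext_iff]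
  have h02 : (0 : Fin (N + 1)) ≠ i₂ := by simp [i₂, Fin.ext_iff]
  have h12 : i₁ ≠ i₂ := by simp [i₁, i₂]
  have hmap : ∀ (J : Ideal (MvPolynomial (Fin (N + 1)) K)) f,
      f ∈ J.map φ ↔ φ.symm f ∈ J := by
    intro J f
    rw [Ideal.mem_map_of_equiv]
    exact ⟨fun ⟨x, hx, hxf⟩ => by rwa [← hxf, AlgEquiv.symm_apply_apply],
      fun hf => ⟨_, hf, AlgEquiv.apply_symm_apply φ f⟩⟩
  have hs : Ideal.span {linearForm v} = (Ideal.span {(X 0 : MvPolynomial (Fin (N + 1)) K)}).map φ := by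
    rw [Ideal.map_span, Set.image_singleton, hφ0]
  refine ⟨φ (X i₁), hφ 1 _ (isHomogeneous_X K _), φ (X i₂), hφ 1 _ (isHomogeneous_X K _),
    fun f hf => ?_, fun k f hf => ?_⟩
  · rw [hs, hmap] at hf ⊢
    rw [map_mul, AlgEquiv.symm_apply_apply] at hf
    have := X_pow_mul_mem_span_X_pow (K := K) h01 1 1 (f := φ.symm f)
    rw [pow_one, pow_one] at this
    exact this hf
  · have hs' : Ideal.span {φ (X i₁) ^ k} =
        (Ideal.span {(X i₁ : MvPolynomial (Fin (N + 1)) K) ^ k}).map φ := by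
      rw [Ideal.map_span, Set.image_singleton, map_pow]
    rw [hs, hs', ← Ideal.map_sup, hmap] at hf ⊢
    rw [map_mul, map_pow, AlgEquiv.symm_apply_apply] at hf
    exact X_pow_mul_mem_sup_span_X_pow h02 h12 k k hf

/-- The dimension of the space of forms of degree `t` is a binomial coefficient. -/
theorem idealDim_homogeneous_top (hN : 1 ≤ N) (t : ℤ) :
    idealDim (homogeneousSubmodule (Fin (N + 1)) K) ⊤ t = binom (t + N) N := by
  rw [idealDim_top]
  by_cases ht : t < 0
  -- The truncation `(t + N).toNat` is below `N` only because `N ≥ 1`.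
  · rw [gradedPiece_of_neg ht, finrank_bot, binom, Nat.choose_eq_zero_of_lt (by omega)]
  · lift t to ℕ using not_lt.1 ht
    rw [gradedPiece_natCast, homogeneousSubmodule_eq_finsupp_supported]
    have h : {d : Fin (N + 1) →₀ ℕ | d.degree = t} =
        (Finset.univ.finsuppAntidiag t : Finset (Fin (N + 1) →₀ ℕ)) := by
      ext d
      simp [Finset.mem_finsuppAntidiag, Finsupp.degree_eq_sum]
    rw [h, (AddMonoidAlgebra.supportedEquivFinsupp (R := K) (S := K) _).finrank_eq,
      Module.finrank_finsupp_self]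
    simp only [Finset.coe_sort_coe, Fintype.card_coe,
      Finset.card_finsuppAntidiag_nat_eq_choose, Finset.card_univ, Fintype.card_fin, binom]
    rw [show N + 1 + t - 1 = t + N by omega, Nat.choose_symm_add]
    norm_cast

end Coordinates

/-! ### Finite intersections of zero-dimensional ideals. -/

section Intersection

variable {K R : Type*} [Field K] [CommRing R] [Algebra K R]
variable {𝒜 : ℕ → Submodule K R} [GradedAlgebra 𝒜]
variable {I J : Ideal R} {ℓ : R}

theorem isZeroDimensional_top (hℓ : ℓ ∈ 𝒜 1) (hℓ0 : ℓ ≠ 0) : IsZeroDimensional 𝒜 ⊤ ℓ where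
  homogeneous := Ideal.IsHomogeneous.top 𝒜
  linear := hℓ
  ne_zero := hℓ0
  regular _ _ := trivial
  bounded := ⟨0, fun t => by rw [add_zero]⟩

variable [∀ d, FiniteDimensional K (𝒜 d)]

/-- Codimension is subadditive under intersection, so the bounds on the Hilbert functions add. -/
theorem IsZeroDimensional.inf (hI : IsZeroDimensional 𝒜 I ℓ) (hJ : IsZeroDimensional 𝒜 J ℓ) :
    IsZeroDimensional 𝒜 (I ⊓ J) ℓ where
  homogeneous := hI.homogeneous.inf hJ.homogeneous
  linear := hI.linear
  ne_zero := hI.ne_zero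
  regular f hf := ⟨hI.regular f hf.1, hJ.regular f hf.2⟩
  bounded := by
    obtain ⟨B, hB⟩ := hI.bounded
    obtain ⟨B', hB'⟩ := hJ.bounded
    refine ⟨B + B', fun t => ?_⟩
    have h1 := Submodule.finrank_sup_add_finrank_inf_eq (idealPiece 𝒜 I t) (idealPiece 𝒜 J t)
    have h2 : idealPiece 𝒜 I t ⊓ idealPiece 𝒜 J t = idealPiece 𝒜 (I ⊓ J) t := by
      ext f
      simp only [Submodule.mem_inf, mem_idealPiece]
      tauto
    have h3 : Module.finrank K (idealPiece 𝒜 I t ⊔ idealPiece 𝒜 J t : Submodule K R) ≤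
        Module.finrank K (gradedPiece 𝒜 t) :=
      Submodule.finrank_mono (sup_le inf_le_left inf_le_left)
    rw [h2] at h1
    have h4 := hB t
    have h5 := hB' t
    rw [idealDim_top] at h4 h5 ⊢
    simp only [idealDim] at *
    omega

theorem isZeroDimensional_iInf {ι : Type*} [Fintype ι] {I : ι → Ideal R} (hℓ : ℓ ∈ 𝒜 1)
    (hℓ0 : ℓ ≠ 0) (h : ∀ i, IsZeroDimensional 𝒜 (I i) ℓ) : IsZeroDimensional 𝒜 (⨅ i, I i) ℓ := by
  classical
  rw [← Finset.inf_univ_eq_iInf]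
  refine Finset.inf_induction (p := fun J => IsZeroDimensional 𝒜 J ℓ)
    (isZeroDimensional_top hℓ hℓ0) (fun _ hI _ hJ => hI.inf hJ) fun i _ => h i

end Intersection

/-! ### Fat points: regularity of a general linear form and boundedness of the Hilbert function. -/

section FatPoint

open MvPolynomial

variable {K : Type*} [Field K] {N : ℕ}

variable (K N) in
/-- The ideal of the point `(1 : 0 : ⋯ : 0)`. -/
def originIdeal : Ideal (MvPolynomial (Fin (N + 1)) K) := Ideal.span (X '' Set.range Fin.succ)

theorem sum_eq_of_coeff_ne_zero {σ : Type*} [Fintype σ] {f : MvPolynomial σ K} {d : ℕ}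
    (hf : f ∈ homogeneousSubmodule σ K d) {s : σ →₀ ℕ} (hs : coeff s f ≠ 0) : ∑ i, s i = d := by
  have h := hf hs
  rwa [Pi.one_def, ← Finsupp.degree_eq_weight_one, Finsupp.degree_eq_sum] at h

/-- Monomial generators free of `x₀` make `x₀` regular modulo the power. -/
theorem exists_originIdeal_pow_eq (m : ℕ) : ∃ A : Set (Fin (N + 1) →₀ ℕ), (∀ s ∈ A, s 0 = 0) ∧
    originIdeal K N ^ m = Ideal.span ((fun s => monomial s (1 : K)) '' A) := by
  induction m with
  | zero =>
    refine ⟨{0}, by simp, ?_⟩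
    simp [Ideal.one_eq_top]
  | succ m ih =>
    obtain ⟨A, hA, h⟩ := ih
    refine ⟨Set.image2 (· + ·) A ((fun i => Finsupp.single i 1) '' Set.range Fin.succ), ?_, ?_⟩
    · rintro _ ⟨s, hs, _, ⟨_, ⟨i, rfl⟩, rfl⟩, rfl⟩
      simp [hA s hs, Fin.succ_ne_zero]
    · rw [pow_succ, h, originIdeal, Ideal.span_mul_span']
      congr 1
      ext f
      simp only [Set.mem_mul, Set.mem_image, Set.mem_image2]
      constructor
      · rintro ⟨_, ⟨s, hs, rfl⟩, _, ⟨_, ⟨i, rfl⟩, rfl⟩, rfl⟩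
        exact ⟨_, ⟨s, hs, _, ⟨_, ⟨i, rfl⟩, rfl⟩, rfl⟩, by simp [X, monomial_mul]⟩
      · rintro ⟨_, ⟨s, hs, _, ⟨_, ⟨i, rfl⟩, rfl⟩, rfl⟩, rfl⟩
        exact ⟨_, ⟨s, hs, rfl⟩, _, ⟨_, ⟨i, rfl⟩, rfl⟩, by simp [X, monomial_mul]⟩

theorem monomial_mem_originIdeal_pow {s : Fin (N + 1) →₀ ℕ} {m : ℕ}
    (h : m ≤ ∑ i : Fin N, s i.succ) (a : K) : monomial s a ∈ originIdeal K N ^ m := by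
  rw [monomial_eq, Finsupp.prod_fintype _ _ (fun _ => pow_zero _), Fin.prod_univ_succ]
  refine Ideal.mul_mem_left _ _ (Ideal.mul_mem_left _ _ (Ideal.pow_le_pow_right h ?_))
  rw [← Finset.prod_pow_eq_pow_sum]
  refine Ideal.prod_mem_prod fun i _ => Ideal.pow_mem_pow ?_ _
  exact Ideal.subset_span ⟨_, ⟨i, rfl⟩, rfl⟩

/-- The Hilbert function of a fat point is bounded. -/
theorem idealDim_originIdeal_pow (m : ℕ) (t : ℤ) :
    idealDim (homogeneousSubmodule (Fin (N + 1)) K) ⊤ t ≤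
      idealDim (homogeneousSubmodule (Fin (N + 1)) K) (originIdeal K N ^ m) t + (m ^ N : ℕ) := by
  classical
  -- A monomial of degree `t` outside the power has all exponents of `x₁, …, x_N` below `m`, and the
  -- exponent of `x₀` is then determined. So `m ^ N` coefficients decide membership. Truncated
  -- subtraction matters only for `u` of sum above `t`, which are never needed.
  let c : (Fin N → Fin m) → (Fin (N + 1) →₀ ℕ) := fun u =>
    Finsupp.equivFunOnFinite.symm (Fin.cons (t.toNat - ∑ i, (u i : ℕ)) fun i => (u i : ℕ))
  let φ : MvPolynomial (Fin (N + 1)) K →ₗ[K] ((Fin N → Fin m) → K) :=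
    LinearMap.pi fun u => lcoeff K (c u)
  have h1 := finrank_map_add_finrank_inf_ker
    (gradedPiece (homogeneousSubmodule (Fin (N + 1)) K) t) φ
  have h2 : Module.finrank K ((gradedPiece (homogeneousSubmodule (Fin (N + 1)) K) t).map φ) ≤
      m ^ N := by
    refine (Submodule.finrank_le _).trans ?_
    simp
  have h3 : gradedPiece (homogeneousSubmodule (Fin (N + 1)) K) t ⊓ LinearMap.ker φ ≤
      idealPiece (homogeneousSubmodule (Fin (N + 1)) K) (originIdeal K N ^ m) t := by
    rintro f ⟨hf, hfk⟩
    refine ⟨hf, ?_⟩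
    by_cases ht : t < 0
    · rw [gradedPiece_of_neg ht] at hf
      rw [(Submodule.mem_bot K).1 hf]
      exact zero_mem _
    lift t to ℕ using not_lt.1 ht
    replace hf : f ∈ homogeneousSubmodule (Fin (N + 1)) K t := mem_of_mem_gradedPiece rfl hf
    change f ∈ originIdeal K N ^ m
    rw [f.as_sum]
    refine Ideal.sum_mem _ fun s hs => monomial_mem_originIdeal_pow ?_ _
    by_contra! hlt
    have hdeg : ∑ i, s i = t := sum_eq_of_coeff_ne_zero hf (mem_support_iff.1 hs)
    have hsu : ∀ i : Fin N, s i.succ < m := fun i =>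
      (Finset.single_le_sum (f := fun i : Fin N => s i.succ) (fun _ _ => Nat.zero_le _)
        (Finset.mem_univ i)).trans_lt hlt
    have hcs : c (fun i => ⟨s i.succ, hsu i⟩) = s := by
      ext j
      refine Fin.cases ?_ (fun i => ?_) j
      · rw [Fin.sum_univ_succ] at hdeg
        simp only [c, Finsupp.equivFunOnFinite_symm_apply_apply, Fin.cons_zero]
        simp
        omega
      · simp [c]
    have hzero : coeff (c (fun i => ⟨s i.succ, hsu i⟩)) f = 0 :=
      congrFun (LinearMap.mem_ker.1 hfk) _
    rw [hcs] at hzero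
    exact (mem_support_iff.1 hs) hzero
  have h4 := Submodule.finrank_mono h3
  rw [idealDim_top]
  simp only [idealDim]
  omega

/-- The ideal of a point, in coordinates adapted to the point. -/
theorem exists_pointIdeal_eq_map (p : ℙ K (Fin (N + 1) → K)) {v : Fin (N + 1) → K}
    (hv : v ⬝ᵥ p.rep ≠ 0) :
    ∃ φ : MvPolynomial (Fin (N + 1)) K ≃ₐ[K] MvPolynomial (Fin (N + 1)) K,
      φ (X 0) = linearForm v ∧
      (∀ d, ∀ f ∈ homogeneousSubmodule (Fin (N + 1)) K d,
        φ f ∈ homogeneousSubmodule (Fin (N + 1)) K d) ∧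
      pointIdeal p = (originIdeal K N).map φ := by
  obtain ⟨φ, hφ0, hφp, hφ, hφs⟩ := exists_coordinates hv
  refine ⟨φ, hφ0, hφ, le_antisymm ?_ ?_⟩
  · refine Ideal.span_le.2 ?_
    rintro f ⟨⟨d, hd⟩, hfp⟩
    have hg := hφs d f hd
    set g := φ.symm f with hgf
    set a := coeff (Finsupp.single 0 d) g with ha
    -- Modulo the ideal of the origin, a form of degree `d` is `a * x₀ ^ d`. Evaluation at `p`,
    -- where `x₀` becomes the nonvanishing `linearForm v`, forces `a = 0`.
    have hgJ : g - monomial (Finsupp.single 0 d) a ∈ originIdeal K N := by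
      rw [originIdeal, mem_ideal_span_X_image]
      intro s hs
      by_contra! hcon
      have hs0 : ∀ i : Fin N, s i.succ = 0 := fun i => hcon _ ⟨i, rfl⟩
      refine mem_support_iff.1 hs ?_
      rw [coeff_sub, coeff_monomial]
      split_ifs with hsd
      · rw [ha, hsd, sub_self]
      · rw [sub_zero]
        by_contra hne
        have hsum := sum_eq_of_coeff_ne_zero hg hne
        rw [Fin.sum_univ_succ, Finset.sum_eq_zero fun i _ => hs0 i, add_zero] at hsum
        refine hsd (Finsupp.ext fun j => ?_)
        refine Fin.cases ?_ (fun i => ?_) j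
        · rw [hsum, Finsupp.single_eq_same]
        · rw [hs0, Finsupp.single_eq_of_ne (Fin.succ_ne_zero i)]
    have hmem := Ideal.mem_map_of_mem φ hgJ
    rw [map_sub, hgf, AlgEquiv.apply_symm_apply] at hmem
    have hker : (originIdeal K N).map φ ≤ RingHom.ker (eval p.rep) := by
      rw [originIdeal, Ideal.map_span, Ideal.span_le]
      rintro _ ⟨_, ⟨_, ⟨i, rfl⟩, rfl⟩, rfl⟩
      exact hφp i
    have hmon : φ (monomial (Finsupp.single 0 d) a) = C a * linearForm v ^ d := by
      rw [← hφ0, ← map_pow, ← C_mul_X_pow_eq_monomial, map_mul]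
      congr 1
      exact φ.commutes a
    have h0 := hker hmem
    rw [hmon, RingHom.mem_ker, map_sub, hfp, zero_sub, neg_eq_zero, map_mul, map_pow, eval_C,
      eval_linearForm] at h0
    have ha0 : a = 0 := (mul_eq_zero.1 h0).resolve_right (pow_ne_zero _ hv)
    rw [ha0, map_zero, map_zero, sub_zero] at hmem
    exact hmem
  · rw [originIdeal, Ideal.map_span, Ideal.span_le]
    rintro _ ⟨_, ⟨_, ⟨i, rfl⟩, rfl⟩, rfl⟩
    exact Ideal.subset_span ⟨⟨1, hφ 1 _ (isHomogeneous_X K _)⟩, hφp i⟩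

theorem isHomogeneous_pointIdeal (p : ℙ K (Fin (N + 1) → K)) :
    (pointIdeal p).IsHomogeneous (homogeneousSubmodule (Fin (N + 1)) K) :=
  Ideal.homogeneous_span _ _ fun _ hf => hf.1

theorem isZeroDimensional_pointIdeal_pow (p : ℙ K (Fin (N + 1) → K)) {v : Fin (N + 1) → K}
    (hv : v ⬝ᵥ p.rep ≠ 0) (m : ℕ) :
    IsZeroDimensional (homogeneousSubmodule (Fin (N + 1)) K) (pointIdeal p ^ m) (linearForm v) := by
  obtain ⟨φ, hφ0, hφ, hp⟩ := exists_pointIdeal_eq_map p hv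
  have hpm : pointIdeal p ^ m = (originIdeal K N ^ m).map φ := by rw [hp, Ideal.map_pow]
  refine ⟨?_, linearForm_mem v, ?_, fun f hf => ?_, ⟨(m ^ N : ℕ), fun t => ?_⟩⟩
  · induction m with
    | zero => simpa [Ideal.one_eq_top] using Ideal.IsHomogeneous.top _
    | succ m ih =>
      rw [pow_succ]
      exact (ih (by rw [hp, Ideal.map_pow])).mul (isHomogeneous_pointIdeal p)
  · rintro h0
    rw [← eval_linearForm, h0, map_zero] at hv
    exact hv rfl
  · rw [hpm, Ideal.mem_map_of_equiv] at hf ⊢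
    obtain ⟨x, hx, hxf⟩ := hf
    refine ⟨φ.symm f, ?_, φ.apply_symm_apply f⟩
    have hx' : x = X 0 ^ 1 * φ.symm f := by
      rw [← φ.symm_apply_apply x]
      rw [show φ x = linearForm v * f from hxf, ← hφ0, map_mul, φ.symm_apply_apply, pow_one]
    obtain ⟨A, hA, h⟩ := exists_originIdeal_pow_eq (K := K) (N := N) m
    rw [h] at hx ⊢
    rw [hx'] at hx
    exact mem_span_monomial_of_X_pow_mul_mem hA hx
  · refine (idealDim_originIdeal_pow m t).trans (add_le_add_left ?_ _)
    rw [hpm]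
    refine Nat.cast_le.2 ?_
    rw [← (Submodule.equivMapOfInjective φ.toLinearMap φ.injective _).symm.finrank_eq]
    refine Submodule.finrank_mono ?_
    rintro _ ⟨f, ⟨hf, hfJ⟩, rfl⟩
    refine ⟨?_, Ideal.mem_map_of_mem φ hfJ⟩
    by_cases ht : t < 0
    · rw [gradedPiece_of_neg ht] at hf ⊢
      rw [(Submodule.mem_bot K).1 hf]
      simp
    · lift t to ℕ using not_lt.1 ht
      exact mem_gradedPiece_of_mem rfl (hφ t f (mem_of_mem_gradedPiece rfl hf))

/-- The ideal of a fat point scheme is the saturated ideal of a zero-dimensional scheme. -/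
theorem exists_isZeroDimensional_fatPointIdeal [Infinite K] {r : ℕ}
    (p : Fin r → ℙ K (Fin (N + 1) → K)) (m : Fin r → ℕ) :
    ∃ ℓ, IsZeroDimensional (homogeneousSubmodule (Fin (N + 1)) K) (fatPointIdeal p m) ℓ := by
  -- The extra vector at `none` keeps the linear form nonzero even when there are no points.
  obtain ⟨e, he⟩ := Module.exists_dual_forall_apply_ne_zero (K := K)
    (fun o : Option (Fin r) => o.elim (Pi.single 0 1 : Fin (N + 1) → K) fun i => (p i).rep) (by
      rintro (_ | i)
      · simp
      · exact (p i).rep_nonzero)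
  have hev : ∀ w, e w = (fun j => e (Pi.single j 1)) ⬝ᵥ w := by
    intro w
    conv_lhs => rw [← Finset.univ_sum_single w]
    rw [map_sum, dotProduct]
    refine Finset.sum_congr rfl fun j _ => ?_
    rw [mul_comm, ← smul_eq_mul, ← map_smul, ← Pi.single_smul, smul_eq_mul, mul_one]
  refine ⟨linearForm fun j => e (Pi.single j 1), isZeroDimensional_iInf (linearForm_mem _) ?_
    fun i => isZeroDimensional_pointIdeal_pow (p i) ?_ (m i)⟩
  · intro h0
    refine he none ?_
    rw [hev, ← eval_linearForm, h0, map_zero]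
  · rw [← hev]
    exact he (some i)

end FatPoint

/-! ### The chain of residuals and one step of the reduction. -/

section Residuals

variable {K : Type*} [Field K] {N n : ℕ}

theorem le_last_add_sum {m : ℕ} (a : Fin (m + 1) → ℤ) (b : Fin m → ℤ)
    (h : ∀ i, a i.castSucc ≤ a i.succ + b i) : a 0 ≤ a (Fin.last m) + ∑ i, b i := by
  induction m with
  | zero => simp
  | succ m ih =>
    have h1 := ih (fun i => a i.castSucc) (fun i => b i.castSucc) fun i => h i.castSucc
    have h2 := h (Fin.last m)
    rw [Fin.sum_univ_castSucc]
    rw [Fin.castSucc_zero] at h1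
    rw [Fin.succ_last] at h2
    linarith

theorem residual_zero (I : Ideal (MvPolynomial (Fin (N + 1)) K))
    (F : Fin (n + 1) → MvPolynomial (Fin (N + 1)) K) : residual I F 0 = I := rfl

theorem residual_succ (I : Ideal (MvPolynomial (Fin (N + 1)) K))
    (F : Fin (n + 1) → MvPolynomial (Fin (N + 1)) K) (j : Fin (n + 1)) :
    residual I F j.succ = Submodule.colon (residual I F j.castSucc) {F j} := rfl

variable {I : Ideal (MvPolynomial (Fin (N + 1)) K)} {ℓ : MvPolynomial (Fin (N + 1)) K}

theorem IsZeroDimensional.residual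
    (h : IsZeroDimensional (MvPolynomial.homogeneousSubmodule (Fin (N + 1)) K) I ℓ)
    {F : Fin (n + 1) → MvPolynomial (Fin (N + 1)) K} (hF : ∀ i, (F i).IsHomogeneous 1)
    (j : Fin (n + 2)) :
    IsZeroDimensional (MvPolynomial.homogeneousSubmodule (Fin (N + 1)) K)
      (FatPoints.residual I F j) ℓ := by
  induction j using Fin.induction with
  | zero => exact h
  | succ j ih =>
    rw [residual_succ]
    exact ih.colon (hF j)

theorem IsZeroDimensional.finrank_idealSections (hN : 1 ≤ N)
    (h : IsZeroDimensional (MvPolynomial.homogeneousSubmodule (Fin (N + 1)) K) I ℓ) (t : ℤ) :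
    FiniteDimensional K (FatPoints.idealSections I t) ∧
      h0Ideal I t = idealDim (MvPolynomial.homogeneousSubmodule (Fin (N + 1)) K) I t := by
  obtain ⟨G, hG, H, hH, hG0, hGH⟩ := exists_regular_pair (K := K) hN
  exact h.idealSections hG hH hG0 hGH t

/-- The inequalities relating a zero-dimensional scheme, its residual and its trace with respect to
a hyperplane. -/
theorem IsZeroDimensional.trace_residual (hN : 2 ≤ N)
    (h : IsZeroDimensional (MvPolynomial.homogeneousSubmodule (Fin (N + 1)) K) I ℓ)
    {F : MvPolynomial (Fin (N + 1)) K} (hF : F.IsHomogeneous 1) (hF0 : F ≠ 0) (t : ℤ) :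
    FiniteDimensional K (FatPoints.traceSections I F t) ∧
    h0Ideal I t ≤ h0Ideal (Submodule.colon I {F}) (t - 1) + h0Trace I F t ∧
    h0Ideal (Submodule.colon I {F}) (t - 1) ≤ h0Ideal I t ∧
    h0Trace I F t + h0O K N (t - 1) - degree (Submodule.colon I {F}) ≤ h0Ideal I t ∧
    h0O K N t - degree I ≤
      h0Trace I F t + h0O K N (t - 1) - degree (Submodule.colon I {F}) := by
  obtain ⟨G, hG, H, hH, hGF, hGH⟩ := exists_regular_pair_mod hN hF hF0
  obtain ⟨Q, hQ, -⟩ := IsZeroDimensional.exists_saturation ℓ (I ⊔ Ideal.span {F})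
  obtain ⟨hfin, htr⟩ := h.traceSections hF hF0 hG hH hGF hGH hQ t
  obtain ⟨h3, h4⟩ := h.saturation_le_idealDim_add hF hF0 hQ t
  have h1 := h.idealDim_le_saturation hF hF0 hQ t
  have h2 := idealDim_colon_le (𝒜 := MvPolynomial.homogeneousSubmodule (Fin (N + 1)) K) (I := I)
    (t := t - 1) (u := t) (d := 1) (by push_cast; ring) hF hF0
  have hN1 : 1 ≤ N := by omega
  have htop := isZeroDimensional_top h.linear h.ne_zero
  have hO : ∀ s, h0O K N s =
      idealDim (MvPolynomial.homogeneousSubmodule (Fin (N + 1)) K) ⊤ s := fun s =>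
    (htop.finrank_idealSections hN1 s).2
  rw [(h.finrank_idealSections hN1 t).2, ((h.colon hF).finrank_idealSections hN1 (t - 1)).2,
    hO, hO]
  have htr' : h0Trace I F t = _ := htr
  simp only [htr']
  unfold degree
  exact ⟨hfin, h1, h2, by linarith, by linarith⟩

end Residuals

end FatPoints

end

/-! ### Assembling the bounds along the chain of residuals. -/

theorem mainTheorem4 {K : Type*} [Field K] [IsAlgClosed K] {N : ℕ} (hN : 2 ≤ N)
    {r : ℕ} (p : Fin r → ℙ K (Fin (N + 1) → K)) (m : Fin r → ℕ)
    {n : ℕ} (F : Fin (n + 1) → MvPolynomial (Fin (N + 1)) K)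
    (hF : ∀ i, (F i).IsHomogeneous 1 ∧ F i ≠ 0)
    (hred : FatPoints.TotallyReduces (FatPoints.fatPointIdeal p m) F) (t : ℤ) :
    -- all the spaces whose dimensions occur below are finite-dimensional
    ((∀ s : ℤ, FiniteDimensional K (FatPoints.structureSections K N s)) ∧
      FiniteDimensional K (FatPoints.idealSections (FatPoints.fatPointIdeal p m) t) ∧
      (∀ i : Fin (n + 1), FiniteDimensional K (FatPoints.traceSections
        (FatPoints.residual (FatPoints.fatPointIdeal p m) F i.castSucc) (F i) (t - (i : ℕ)))) ∧
      (∀ i : Fin (n + 2), FiniteDimensional K (FatPoints.schemeSections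
        (FatPoints.residual (FatPoints.fatPointIdeal p m) F i)))) ∧
    Finset.univ.sup' Finset.univ_nonempty
        (FatPoints.lowerTerm' (FatPoints.fatPointIdeal p m) F t) ≤
      Finset.univ.sup' Finset.univ_nonempty
        (FatPoints.lowerTerm (FatPoints.fatPointIdeal p m) F t) ∧
    Finset.univ.sup' Finset.univ_nonempty
        (FatPoints.lowerTerm (FatPoints.fatPointIdeal p m) F t) ≤
      FatPoints.h0Ideal (FatPoints.fatPointIdeal p m) t ∧
    FatPoints.h0Ideal (FatPoints.fatPointIdeal p m) t ≤
      FatPoints.binom (t - n + N - 1) N +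
        ∑ i : Fin (n + 1), FatPoints.h0Trace
          (FatPoints.residual (FatPoints.fatPointIdeal p m) F i.castSucc) (F i) (t - (i : ℕ)) := by
  classical
  obtain ⟨ℓ, hℓ⟩ := FatPoints.exists_isZeroDimensional_fatPointIdeal p m
  set I := FatPoints.fatPointIdeal p m with hI
  have hN1 : 1 ≤ N := by omega
  have hres := hℓ.residual (fun i => (hF i).1)
  have hstep := fun i : Fin (n + 1) =>
    (hres i.castSucc).trace_residual hN (hF i).1 (hF i).2 (t - (i : ℕ))
  simp only [← FatPoints.residual_succ, sub_sub] at hstep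
  have hlast : FatPoints.residual I F (Fin.last (n + 1)) = ⊤ :=
    (hres (Fin.last (n + 1))).eq_top_of_zeroLocus_eq_empty hred
  have htop := FatPoints.isZeroDimensional_top hℓ.linear hℓ.ne_zero
  have hO : ∀ s, FatPoints.h0O K N s = FatPoints.binom (s + N) N := fun s =>
    (htop.finrank_idealSections hN1 s).2.trans (FatPoints.idealDim_homogeneous_top hN1 s)
  have hdeg : FatPoints.degree (FatPoints.residual I F (Fin.last (n + 1))) = 0 := by
    rw [hlast]
    obtain ⟨-, d₀, hd₀⟩ := htop.schemeSections
    exact (hd₀ d₀ le_rfl).trans (sub_self _)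
  -- Since the last residual has degree zero, the exceptional last cases in both families follow the
  -- general formula.
  have hlow : ∀ i, FatPoints.lowerTerm I F t i =
      FatPoints.h0Trace (FatPoints.residual I F i.castSucc) (F i) (t - (i : ℕ)) +
        FatPoints.h0O K N (t - ((i : ℕ) + 1)) -
          FatPoints.degree (FatPoints.residual I F i.succ) := by
    intro i
    unfold FatPoints.lowerTerm
    split_ifs with hi
    · rfl
    · obtain rfl : i = Fin.last n := Fin.ext (by have := i.2; simp only [Fin.val_last]; omega)
      rw [Fin.succ_last, hdeg, sub_zero, hO, Fin.val_last]
  have hlow' : ∀ i : Fin (n + 2), FatPoints.lowerTerm' I F t i =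
      FatPoints.h0O K N (t - (i : ℕ)) - FatPoints.degree (FatPoints.residual I F i) := by
    intro i
    unfold FatPoints.lowerTerm'
    split_ifs with hi
    · rfl
    · obtain rfl : i = Fin.last (n + 1) :=
        Fin.ext (by have := i.2; simp only [Fin.val_last]; omega)
      rw [hdeg, sub_zero, Fin.val_last]
      push_cast
      rfl
  refine ⟨⟨fun s => (htop.finrank_idealSections hN1 s).1, (hℓ.finrank_idealSections hN1 t).1,
    fun i => (hstep i).1, fun i => (hres i).schemeSections.1⟩, ?_, ?_, ?_⟩
  · refine Finset.sup'_le _ _ fun i _ => ?_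
    refine Fin.lastCases ?_ (fun j => ?_) i
    · refine le_trans ?_ (Finset.le_sup' _ (Finset.mem_univ (Fin.last n)))
      rw [hlow', hlow, Fin.succ_last, hdeg, sub_zero, sub_zero, Fin.val_last, Fin.val_last]
      push_cast
      exact le_add_of_nonneg_left (Int.natCast_nonneg _)
    · refine le_trans ?_ (Finset.le_sup' _ (Finset.mem_univ j))
      rw [hlow', hlow]
      exact (hstep j).2.2.2.2
  · refine Finset.sup'_le _ _ fun i _ => ?_
    -- Multiplication by the successive linear forms embeds the sections of each residual into those
    -- of `A₀`.
    have hmono : ∀ j : Fin (n + 2),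
        FatPoints.h0Ideal (FatPoints.residual I F j) (t - (j : ℕ)) ≤ FatPoints.h0Ideal I t := by
      intro j
      induction j using Fin.induction with
      | zero => simp [FatPoints.residual_zero]
      | succ j ih =>
        refine le_trans ?_ ih
        have := (hstep j).2.2.1
        rw [Fin.val_succ]
        push_cast
        exact this
    rw [hlow]
    exact (hstep i).2.2.2.1.trans (hmono i.castSucc)
  · have hsum := FatPoints.le_last_add_sum
      (fun j : Fin (n + 2) => FatPoints.h0Ideal (FatPoints.residual I F j) (t - (j : ℕ)))
      (fun i => FatPoints.h0Trace (FatPoints.residual I F i.castSucc) (F i) (t - (i : ℕ)))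
      fun i => by
        have := (hstep i).2.1
        rw [Fin.val_succ]
        push_cast
        exact this
    -- The telescoped sum ends with the empty scheme, contributing all forms of degree `t - (n +
    -- 1)`.
    have hlastO : FatPoints.h0Ideal (FatPoints.residual I F (Fin.last (n + 1)))
        (t - ((Fin.last (n + 1) : Fin (n + 2)) : ℕ)) = FatPoints.binom (t - n + N - 1) N := by
      rw [hlast, Fin.val_last]
      refine (hO _).trans ?_
      congr 1
      push_cast
      ring
    simp only [hlastO] at hsum
    simpa [FatPoints.residual_zero] using hsum
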